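/- Let $d>0$ and $r_n=d(n+\tfrac12)$, $n=0,1,2,\dots$. For $\alpha\in(0,\tfrac12)$, $\beta\in\mathbb R$ and $l\in\mathbb Z$ put $c_{\alpha,l}=-\tfrac14+(l+\alpha)^2$, and let $H_{\alpha;\beta,l}$ be the operator in $L^2(0,\infty)$ acting as $$H_{\alpha;\beta,l}f=-f''+\frac{c_{\alpha,l}}{r^2}f\qquad\text{on }(0,\infty)\setminus\{r_n:n\ge 0\},$$ whose domain consists of the $f\in L^2(0,\infty)$ that are continuous on $(0,\infty)$, are differentiable off the points $r_n$ with $f'$ absolutely continuous on every compact interval in $(0,\infty)\setminus\{r_n\}$, satisfy $-f''+c_{\alpha,l}r^{-2}f\in L^2(0,\infty)$ and $$f'(r_n+)-f'(r_n-)=\beta f(r_n)\qquad(n\ge 0),$$ and, in addition, $\lim_{r\to0+}r^{\alpha-1/2}f(r)=0$ if $l=0$ and $\lim_{r\to0+}r^{(1-\alpha)-1/2}f(r)=0$ if $l=-1$. Let $H_{\alpha;\beta}$ be the operator in $L^2(\mathbb R^2)$ (the Aharonov-Bohm Hamiltonian of flux $\alpha$ with a $\delta$ interaction of strength $\beta$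 on the circles of radii $r_n$ about the origin) which is the orthogonal sum $$H_{\alpha;\beta}=\bigoplus_{l\in\mathbb Z}U^{-1}H_{\alpha;\beta,l}U\otimes I_l$$ with respect to $L^2(\mathbb R^2)=\bigoplus_{l\in\mathbb Z}L^2(\mathbb R_+,r\,dr)\otimes S_l$, where $S_l=\mathbb C e^{il\theta}$, $I_l$ is the identity on $S_l$ and $(Uf)(r)=r^{1/2}f(r)$. The discrete spectrum of an operator is the set of isolated points of its spectrum that are eigenvalues of finite multiplicity. **Theorem.** For every $d>0$ and every $\alpha\in(0,\tfrac12)$ there is $\beta_0>0$ such that for all $\beta\in\mathbb R$ with $|\beta|<\beta_0$ the operator $H_{\alpha;\beta}$ has no discrete spectrum. -/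

import Mathlib

noncomputable section

open MeasureTheory Set Filter Topology Complex

namespace LinearPMap

variable {E : Type*} [NormedAddCommGroup E] [NormedSpace ℂ E]

/-- `z` is in the resolvent set of the (possibly unbounded) operator `T`: the map
`T - z : D(T) → E` is a bijection with a bounded everywhere defined inverse `R`. -/
def IsRegularValue (T : E →ₗ.[ℂ] E) (z : ℂ) : Prop :=
  ∃ R : E →L[ℂ] E,
    (∀ x : T.domain, R (T x - z • (x : E)) = x) ∧
    (∀ y : E, ∃ x : T.domain, (x : E) = R y ∧ T x - z • (x : E) = y)

/-- The spectrum of an unbounded operator: the complement of its resolvent set. -/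
def opSpectrum (T : E →ₗ.[ℂ] E) : Set ℂ := {z | ¬ T.IsRegularValue z}

/-- The kernel of `T - z` as a subspace of `E`. -/
def eigenspace (T : E →ₗ.[ℂ] E) (z : ℂ) : Submodule ℂ E where
  carrier := {x | ∃ h : x ∈ T.domain, T ⟨x, h⟩ = z • x}
  zero_mem' := ⟨T.domain.zero_mem, by
    rw [smul_zero]
    exact T.map_zero⟩
  add_mem' := by
    rintro x y ⟨hx, hx'⟩ ⟨hy, hy'⟩
    refine ⟨T.domain.add_mem hx hy, ?_⟩
    have h := T.map_add ⟨x, hx⟩ ⟨y, hy⟩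
    rw [hx', hy', ← smul_add] at h
    exact h
  smul_mem' := by
    rintro c x ⟨hx, hx'⟩
    refine ⟨T.domain.smul_mem c hx, ?_⟩
    have h := T.map_smul c ⟨x, hx⟩
    rw [hx', smul_comm] at h
    exact h

/-- The discrete spectrum (of a self-adjoint operator): the isolated points of the spectrum that
are eigenvalues of finite multiplicity. -/
def discreteSpectrum (T : E →ₗ.[ℂ] E) : Set ℂ :=
  {z | z ∈ T.opSpectrum ∧ (∃ ε > 0, ∀ w ∈ T.opSpectrum, ‖w - z‖ < ε → w = z) ∧
    T.eigenspace z ≠ ⊥ ∧ FiniteDimensional ℂ (T.eigenspace z)}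

end LinearPMap

namespace AharonovBohm

/-- The radius `r_n = d (n + 1/2)`, `n = 0, 1, …`, of the `n`-th circle. -/
def radius (d : ℝ) (n : ℕ) : ℝ := d * (n + 1 / 2)

/-- The centrifugal coefficient `c_{α,l} = -1/4 + (l + α)²`. -/
def centrifugal (α : ℝ) (l : ℤ) : ℝ := -1 / 4 + (l + α) ^ 2

/-- Lebesgue measure on the half-line `(0, ∞)`. -/
abbrev halfLine : Measure ℝ := volume.restrict (Ioi 0)

/-- The regularity, matching and boundary conditions for a function `F` on `(0, ∞)` in the domain
of the radial operator `-d²/dr² + c_{α,l} / r²` with `δ` interactions of strength `β` at the radii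
`r_n`, together with the statement that the operator sends `F` to `g`. The function `dF` is the
derivative of `F` off the radii. -/
structure IsRadialPair (d α β : ℝ) (l : ℤ) (F dF g : ℝ → ℂ) : Prop where
  continuousOn : ContinuousOn F (Ioi 0)
  hasDerivAt : ∀ r > 0, (∀ n, r ≠ radius d n) → HasDerivAt F (dF r) r
  /-- On each interval without radii, `dF` is locally absolutely continuous, with
  `-(dF)' + c_{α,l} r⁻² F = g` almost everywhere. -/
  integral_eq : ∀ a b, 0 < a → a ≤ b → (∀ n, radius d n ∉ Icc a b) →
    dF b - dF a = ∫ s in a..b, ((centrifugal α l / s ^ 2 : ℝ) * F s - g s)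
  /-- `dF(r_n+) - dF(r_n-) = β F(r_n)`. -/
  jump : ∀ n, ∃ p m : ℂ, Tendsto dF (𝓝[>] (radius d n)) (𝓝 p) ∧
    Tendsto dF (𝓝[<] (radius d n)) (𝓝 m) ∧ p - m = β * F (radius d n)
  /-- The boundary condition at the origin in the partial wave `l = 0`. -/
  bc_zero : l = 0 → Tendsto (fun r : ℝ ↦ ((r ^ (α - 1 / 2) : ℝ) : ℂ) * F r) (𝓝[>] 0) (𝓝 0)
  /-- The boundary condition at the origin in the partial wave `l = -1`. -/
  bc_neg_one : l = -1 →
    Tendsto (fun r : ℝ ↦ ((r ^ (1 - α - 1 / 2) : ℝ) : ℂ) * F r) (𝓝[>] 0) (𝓝 0)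

/-- The radial operator `H_{α;β,l}` in `L²(0, ∞)`, given by its graph: `f` (up to equality almost
everywhere) is in the domain of `H_{α;β,l}` and `H_{α;β,l} f = g`. -/
def RadialGraph (d α β : ℝ) (l : ℤ) (f g : ℝ → ℂ) : Prop :=
  MemLp f 2 halfLine ∧ MemLp g 2 halfLine ∧
    ∃ F dF : ℝ → ℂ, f =ᵐ[halfLine] F ∧ IsRadialPair d α β l F dF g

/-- The plane `ℝ²` is represented by `ℂ` with Lebesgue measure; this is `L²(ℝ²)`. -/
abbrev PlaneL2 : Type := Lp ℂ 2 (volume : Measure ℂ)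

/-- The `l`-th partial wave of `f`, transported to `L²(0, ∞)` by `U f(r) = r^{1/2} f(r)`:
`f_l(r) = r^{1/2} (2π)^{-1/2} ∫_{-π}^{π} f(r e^{iθ}) e^{-ilθ} dθ`, so that
`f(r e^{iθ}) = r^{-1/2} ∑_l f_l(r) (2π)^{-1/2} e^{ilθ}` in `L²(ℝ²)`. -/
def partialWave (l : ℤ) (f : ℂ → ℂ) (r : ℝ) : ℂ :=
  ((√r / √(2 * Real.pi) : ℝ) : ℂ) *
    ∫ θ in (-Real.pi)..Real.pi, f (r * exp (θ * I)) * exp (-(l * θ * I))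

/- Slices in polar coordinates. -/

lemma polar_aux (r θ : ℝ) : Complex.polarCoord.symm (r, θ) = r * exp (θ * I) := by
  rw [Complex.polarCoord_symm_apply, exp_mul_I]; simp

lemma lintegral_polar {h : ℂ → ENNReal} (hh : Measurable h) :
    ∫⁻ z, h z = ∫⁻ r in Ioi (0 : ℝ), ∫⁻ θ in Ioc (-Real.pi) Real.pi,
      ENNReal.ofReal r * h (r * exp (θ * I)) := by
  have hm : Measurable fun p : ℝ × ℝ ↦ ENNReal.ofReal p.1 * h (p.1 * exp (p.2 * I)) := by
    have h1 : Measurable fun p : ℝ × ℝ ↦ ((p.1 : ℂ) * exp (p.2 * I)) := by fun_prop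
    exact (ENNReal.measurable_ofReal.comp measurable_fst).mul (hh.comp h1)
  rw [← Complex.lintegral_comp_polarCoord_symm]
  have : polarCoord.target = Ioi (0 : ℝ) ×ˢ Ioo (-Real.pi) Real.pi := rfl
  rw [this, Measure.volume_eq_prod, ← Measure.prod_restrict,
    Measure.restrict_congr_set (Ioo_ae_eq_Ioc (a := -Real.pi) (b := Real.pi))]
  have := lintegral_prod (μ := volume.restrict (Ioi (0 : ℝ)))
    (ν := volume.restrict (Ioc (-Real.pi) Real.pi)) _ hm.aemeasurable
  rw [← this]
  refine lintegral_congr fun p ↦ ?_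
  rw [← polar_aux, smul_eq_mul]

lemma slice_ae {P : ℂ → Prop} (hP : ∀ᵐ z, P z) :
    ∀ᵐ (r : ℝ) ∂halfLine, ∀ᵐ (θ : ℝ) ∂(volume.restrict (Ioc (-Real.pi) Real.pi)),
      P ((r : ℂ) * exp ((θ : ℂ) * I)) := by
  obtain ⟨N, hN, hNm, hN0⟩ := exists_measurable_superset_of_null (ae_iff.1 hP)
  have h0 : ∫⁻ z, N.indicator 1 z = 0 := by rw [lintegral_indicator_one hNm, hN0]
  have hmeas : Measurable (N.indicator (1 : ℂ → ENNReal)) := measurable_one.indicator hNm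
  rw [lintegral_polar hmeas] at h0
  have hm : Measurable fun p : ℝ × ℝ ↦
      ENNReal.ofReal p.1 * N.indicator (1 : ℂ → ENNReal) (p.1 * exp (p.2 * I)) := by
    have h1 : Measurable fun p : ℝ × ℝ ↦ ((p.1 : ℂ) * exp (p.2 * I)) := by fun_prop
    exact (ENNReal.measurable_ofReal.comp measurable_fst).mul (hmeas.comp h1)
  rw [lintegral_eq_zero_iff hm.lintegral_prod_right'] at h0
  filter_upwards [h0, ae_restrict_mem measurableSet_Ioi] with r hr hrpos
  have h2 := hr
  simp only [Pi.zero_apply] at h2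
  have hmr : Measurable fun θ : ℝ ↦
      ENNReal.ofReal r * N.indicator (1 : ℂ → ENNReal) (r * exp (θ * I)) :=
    hm.comp measurable_prodMk_left
  rw [lintegral_eq_zero_iff hmr] at h2
  filter_upwards [h2] with θ hθ
  by_contra hcon
  have hmem : (r : ℂ) * exp (θ * I) ∈ N := hN hcon
  simp [hmem] at hθ
  exact absurd hrpos (not_lt.2 hθ)

lemma ae_of_slice {f : ℂ → ℂ} (hf : Measurable f)
    (h : ∀ᵐ (r : ℝ) ∂halfLine, ∀ᵐ (θ : ℝ) ∂(volume.restrict (Ioc (-Real.pi) Real.pi)),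
      f ((r : ℂ) * exp ((θ : ℂ) * I)) = 0) : f =ᵐ[volume] 0 := by
  have : ∫⁻ z, ‖f z‖ₑ = 0 := by
    rw [lintegral_polar hf.enorm]
    rw [lintegral_congr_ae (g := fun _ ↦ 0)]
    · simp
    filter_upwards [h] with r hr
    rw [lintegral_congr_ae (g := fun _ ↦ 0)]
    · simp
    filter_upwards [hr] with θ hθ
    simp [hθ]
  rw [lintegral_eq_zero_iff hf.enorm] at this
  filter_upwards [this] with z hz
  simpa using hz

lemma slice_memLp (f : PlaneL2) :
    ∀ᵐ (r : ℝ) ∂halfLine, MemLp (fun θ : ℝ ↦ f ((r : ℂ) * exp ((θ : ℂ) * I))) 2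
      (volume.restrict (Ioc (-Real.pi) Real.pi)) := by
  have hf : Measurable f := (Lp.stronglyMeasurable f).measurable
  have hfin : ∫⁻ z, ‖f z‖ₑ ^ (2 : ℝ) < ⊤ := by
    have := lintegral_rpow_enorm_lt_top_of_eLpNorm_lt_top (μ := volume) (f := f) (p := 2)
      (by norm_num) (by norm_num) (Lp.memLp f).2
    simpa using this
  have hmeas : Measurable fun z ↦ ‖f z‖ₑ ^ (2 : ℝ) := hf.enorm.pow_const _
  rw [lintegral_polar hmeas] at hfin
  have hm : Measurable fun p : ℝ × ℝ ↦
      ENNReal.ofReal p.1 * ‖f (p.1 * exp (p.2 * I))‖ₑ ^ (2 : ℝ) := by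
    have h1 : Measurable fun p : ℝ × ℝ ↦ ((p.1 : ℂ) * exp (p.2 * I)) := by fun_prop
    exact (ENNReal.measurable_ofReal.comp measurable_fst).mul (hmeas.comp h1)
  filter_upwards [ae_lt_top hm.lintegral_prod_right' hfin.ne,
    ae_restrict_mem measurableSet_Ioi] with r hr hrpos
  have h1 : Measurable fun θ : ℝ ↦ ((r : ℂ) * exp ((θ : ℂ) * I)) := by fun_prop
  refine ⟨(hf.comp h1).aestronglyMeasurable, ?_⟩
  rw [eLpNorm_lt_top_iff_lintegral_rpow_enorm_lt_top (by norm_num) (by norm_num)]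
  have hmr : Measurable fun θ : ℝ ↦ ‖f (r * exp (θ * I))‖ₑ ^ (2 : ℝ) := hmeas.comp h1
  rw [lintegral_const_mul _ hmr] at hr
  have hne : ENNReal.ofReal r ≠ 0 := by simpa using hrpos
  have := ENNReal.lt_top_of_mul_ne_top_right hr.ne hne
  simpa using this

lemma slice_integrable (f : PlaneL2) (l : ℤ) :
    ∀ᵐ (r : ℝ) ∂halfLine, IntervalIntegrable
      (fun θ : ℝ ↦ f ((r : ℂ) * exp ((θ : ℂ) * I)) * exp (-(l * θ * I)))
      volume (-Real.pi) Real.pi := by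
  filter_upwards [slice_memLp f] with r hr
  have h1 : IntervalIntegrable (fun θ : ℝ ↦ f ((r : ℂ) * exp ((θ : ℂ) * I)))
      volume (-Real.pi) Real.pi := by
    rw [intervalIntegrable_iff_integrableOn_Ioc_of_le (by linarith [Real.pi_pos])]
    exact hr.integrable (by norm_num)
  exact h1.mul_continuousOn (by fun_prop)

lemma partialWave_congr {f g : ℂ → ℂ} (h : f =ᵐ[volume] g) (l : ℤ) :
    partialWave l f =ᵐ[halfLine] partialWave l g := by
  filter_upwards [slice_ae h] with r hr
  unfold partialWave
  congr 1
  rw [intervalIntegral.integral_of_le (by linarith [Real.pi_pos]),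
    intervalIntegral.integral_of_le (by linarith [Real.pi_pos])]
  refine integral_congr_ae ?_
  filter_upwards [hr] with θ hθ
  rw [hθ]

lemma partialWave_zero (l : ℤ) : partialWave l (0 : PlaneL2) =ᵐ[halfLine] 0 := by
  refine (partialWave_congr (Lp.coeFn_zero ℂ 2 volume) l).trans ?_
  filter_upwards with r
  simp [partialWave]

lemma partialWave_add (f g : PlaneL2) (l : ℤ) :
    partialWave l (f + g : PlaneL2) =ᵐ[halfLine] partialWave l f + partialWave l g := by
  refine (partialWave_congr (Lp.coeFn_add f g) l).trans ?_
  filter_upwards [slice_integrable f l, slice_integrable g l] with r hf hg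
  simp only [partialWave, Pi.add_apply, add_mul]
  rw [intervalIntegral.integral_add hf hg, mul_add]

lemma partialWave_smul (c : ℂ) (f : PlaneL2) (l : ℤ) :
    partialWave l (c • f : PlaneL2) =ᵐ[halfLine] c • partialWave l f := by
  refine (partialWave_congr (Lp.coeFn_smul c f) l).trans ?_
  filter_upwards with r
  simp only [partialWave, Pi.smul_apply, smul_eq_mul, mul_assoc]
  rw [intervalIntegral.integral_const_mul]
  ring

/-- The partial waves determine a function in `L²(ℝ²)`. -/
lemma eq_zero_of_partialWave (f : PlaneL2)
    (h : ∀ l : ℤ, partialWave l f =ᵐ[halfLine] 0) : f = 0 := by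
  have hf : Measurable f := (Lp.stronglyMeasurable f).measurable
  rw [Lp.eq_zero_iff_ae_eq_zero]
  refine ae_of_slice hf ?_
  filter_upwards [slice_memLp f, ae_all_iff.2 h, ae_restrict_mem measurableSet_Ioi]
    with r hr hl hrpos
  have hpi : -Real.pi < Real.pi := by linarith [Real.pi_pos]
  have hF : ∀ l : ℤ, fourierCoeffOn hpi (fun θ : ℝ ↦ f ((r : ℂ) * exp ((θ : ℂ) * I))) l = 0 := by
    intro l
    have h1 := hl l
    have hr0 : (0 : ℝ) < r := hrpos
    have hne : ((√r / √(2 * Real.pi) : ℝ) : ℂ) ≠ 0 := by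
      rw [Complex.ofReal_ne_zero]; positivity
    simp only [partialWave, Pi.zero_apply, mul_eq_zero, hne, false_or] at h1
    rw [fourierCoeffOn_eq_integral]
    convert! smul_zero _
    rw [← h1]
    refine intervalIntegral.integral_congr fun θ _ ↦ ?_
    simp only [fourier_coe_apply, smul_eq_mul]
    rw [mul_comm]
    congr 2
    have : (Real.pi : ℂ) ≠ 0 := by exact_mod_cast Real.pi_ne_zero
    push_cast
    field_simp
    ring
  have hs := hasSum_sq_fourierCoeffOn hpi hr
  simp only [hF, norm_zero, ne_eq, OfNat.ofNat_ne_zero, not_false_eq_true, zero_pow] at hs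
  have h0 := hs.unique hasSum_zero
  rw [smul_eq_zero, intervalIntegral.integral_of_le hpi.le] at h0
  have h2 : ∫ θ in Ioc (-Real.pi) Real.pi, ‖f ((r : ℂ) * exp ((θ : ℂ) * I))‖ ^ 2 = 0 := by
    refine h0.resolve_left ?_
    have := Real.pi_pos
    positivity
  rw [integral_eq_zero_iff_of_nonneg (fun _ ↦ by positivity)
    ((memLp_two_iff_integrable_sq_norm hr.1).1 hr)] at h2
  filter_upwards [h2] with θ hθ
  simpa using hθ

/- The radial operators are linear and single-valued. -/

lemma MemLp.intervalIntegrable_pos {g : ℝ → ℂ} (hg : MemLp g 2 halfLine) {a b : ℝ} (ha : 0 < a)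
    (hab : a ≤ b) : IntervalIntegrable g volume a b := by
  rw [intervalIntegrable_iff_integrableOn_Ioc_of_le hab]
  have h1 : MemLp g 2 (volume.restrict (Ioc a b)) :=
    hg.mono_measure (Measure.restrict_mono (fun x hx ↦ ha.trans hx.1) le_rfl)
  exact h1.integrable (by norm_num)

lemma intervalIntegrable_radial {α : ℝ} {l : ℤ} {F g : ℝ → ℂ} (hF : ContinuousOn F (Ioi 0))
    (hg : MemLp g 2 halfLine) {a b : ℝ} (ha : 0 < a) (hab : a ≤ b) :
    IntervalIntegrable (fun s ↦ ((centrifugal α l / s ^ 2 : ℝ) : ℂ) * F s - g s) volume a b := by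
  refine IntervalIntegrable.sub (ContinuousOn.intervalIntegrable ?_)
    (MemLp.intervalIntegrable_pos hg ha hab)
  rw [uIcc_of_le hab]
  have hsub : Icc a b ⊆ Ioi 0 := fun x hx ↦ ha.trans_le hx.1
  refine ContinuousOn.mul ?_ (hF.mono hsub)
  refine Complex.continuous_ofReal.comp_continuousOn ?_
  refine continuousOn_const.div (by fun_prop) fun x hx ↦ ?_
  have : 0 < x := hsub hx
  positivity

lemma RadialGraph.congr {d α β : ℝ} {l : ℤ} {f₁ f₂ g₁ g₂ : ℝ → ℂ} (hf : f₁ =ᵐ[halfLine] f₂)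
    (hg : g₁ =ᵐ[halfLine] g₂) (h : RadialGraph d α β l f₁ g₁) : RadialGraph d α β l f₂ g₂ := by
  obtain ⟨h1, h2, F, dF, hF, h3⟩ := h
  refine ⟨(memLp_congr_ae hf).1 h1, (memLp_congr_ae hg).1 h2, F, dF, hf.symm.trans hF,
    { h3 with integral_eq := fun a b ha hab hn ↦ ?_ }⟩
  rw [h3.integral_eq a b ha hab hn, intervalIntegral.integral_of_le hab,
    intervalIntegral.integral_of_le hab]
  refine integral_congr_ae ?_
  have hle : volume.restrict (Ioc a b) ≤ halfLine :=
    Measure.restrict_mono (fun x hx ↦ ha.trans hx.1) le_rfl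
  filter_upwards [ae_mono hle hg] with s hs
  rw [hs]

lemma RadialGraph.zero (d α β : ℝ) (l : ℤ) : RadialGraph d α β l 0 0 := by
  refine ⟨MemLp.zero, MemLp.zero, 0, 0, EventuallyEq.rfl, ?_⟩
  refine ⟨continuousOn_const, fun r _ _ ↦ hasDerivAt_const r 0, ?_, ?_, ?_, ?_⟩
  · intros; simp
  · exact fun n ↦ ⟨0, 0, tendsto_const_nhds, tendsto_const_nhds, by simp⟩
  · intro; simp
  · intro; simp

lemma RadialGraph.add {d α β : ℝ} {l : ℤ} {f₁ f₂ g₁ g₂ : ℝ → ℂ}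
    (h₁ : RadialGraph d α β l f₁ g₁) (h₂ : RadialGraph d α β l f₂ g₂) :
    RadialGraph d α β l (f₁ + f₂) (g₁ + g₂) := by
  obtain ⟨a1, b1, F, dF, hF, c1⟩ := h₁
  obtain ⟨a2, b2, G, dG, hG, c2⟩ := h₂
  refine ⟨a1.add a2, b1.add b2, F + G, dF + dG, hF.add hG, ?_⟩
  refine ⟨c1.continuousOn.add c2.continuousOn,
    fun r hr hn ↦ (c1.hasDerivAt r hr hn).add (c2.hasDerivAt r hr hn), ?_, ?_, ?_, ?_⟩
  · intro a b ha hab hn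
    have e1 := c1.integral_eq a b ha hab hn
    have e2 := c2.integral_eq a b ha hab hn
    have e3 := intervalIntegral.integral_add
      (intervalIntegrable_radial (α := α) (l := l) c1.continuousOn b1 ha hab)
      (intervalIntegrable_radial (α := α) (l := l) c2.continuousOn b2 ha hab)
    rw [← e1, ← e2] at e3
    calc (dF + dG) b - (dF + dG) a = dF b - dF a + (dG b - dG a) := by
          simp only [Pi.add_apply]; ring
      _ = _ := by
          rw [← e3]
          congr 1
          funext s
          simp only [Pi.add_apply]; ring
  · intro n
    obtain ⟨p, m, hp, hm, e⟩ := c1.jump n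
    obtain ⟨p', m', hp', hm', e'⟩ := c2.jump n
    refine ⟨p + p', m + m', hp.add hp', hm.add hm', ?_⟩
    simp only [Pi.add_apply, mul_add]
    rw [← e, ← e']; ring
  · intro hl
    have := (c1.bc_zero hl).add (c2.bc_zero hl)
    simpa [mul_add] using this
  · intro hl
    have := (c1.bc_neg_one hl).add (c2.bc_neg_one hl)
    simpa [mul_add] using this

lemma RadialGraph.smul {d α β : ℝ} {l : ℤ} {f g : ℝ → ℂ} (c : ℂ)
    (h : RadialGraph d α β l f g) : RadialGraph d α β l (c • f) (c • g) := by
  obtain ⟨a1, b1, F, dF, hF, c1⟩ := h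
  refine ⟨a1.const_smul c, b1.const_smul c, c • F, c • dF, hF.const_smul c, ?_⟩
  refine ⟨c1.continuousOn.const_smul c,
    fun r hr hn ↦ (c1.hasDerivAt r hr hn).const_smul c, ?_, ?_, ?_, ?_⟩
  · intro a b ha hab hn
    have e1 := c1.integral_eq a b ha hab hn
    calc (c • dF) b - (c • dF) a = c * (dF b - dF a) := by
          simp only [Pi.smul_apply, smul_eq_mul]; ring
      _ = _ := by
          rw [e1, ← intervalIntegral.integral_const_mul]
          congr 1
          funext s
          simp only [Pi.smul_apply, smul_eq_mul]; ring
  · intro n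
    obtain ⟨p, m, hp, hm, e⟩ := c1.jump n
    refine ⟨c * p, c * m, hp.const_mul c, hm.const_mul c, ?_⟩
    simp only [Pi.smul_apply, smul_eq_mul]
    rw [← mul_sub, e]; ring
  · intro hl
    have := (c1.bc_zero hl).const_mul c
    simpa [mul_left_comm] using this
  · intro hl
    have := (c1.bc_neg_one hl).const_mul c
    simpa [mul_left_comm] using this

lemma isClosed_radii {d : ℝ} (hd : 0 < d) : IsClosed (range (radius d)) := by
  have h1 : IsClosed (range ((↑) : ℕ → ℝ)) := Nat.isClosedEmbedding_coe_real.isClosed_range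
  have h2 : range (radius d) = (fun x : ℝ ↦ x / d - 1 / 2) ⁻¹' range ((↑) : ℕ → ℝ) := by
    ext x
    simp only [mem_range, mem_preimage, radius]
    refine exists_congr fun n ↦ ?_
    constructor
    · rintro rfl
      field_simp
      ring
    · intro h
      rw [h]
      field_simp
      ring
  rw [h2]
  exact h1.preimage (by fun_prop)

lemma RadialGraph.eq_zero {d α β : ℝ} (hd : 0 < d) {l : ℤ} {f g : ℝ → ℂ}
    (hf : f =ᵐ[halfLine] 0) (h : RadialGraph d α β l f g) : g =ᵐ[halfLine] 0 := by
  obtain ⟨-, hg, F, dF, hF, c⟩ := h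
  have hF0 : EqOn F 0 (Ioi 0) :=
    Measure.eqOn_open_of_ae_eq (hF.symm.trans hf) isOpen_Ioi c.continuousOn continuousOn_const
  have hF' : ∀ r > 0, (∀ n, r ≠ radius d n) → dF r = 0 := by
    intro r hr hn
    have h1 : F =ᶠ[𝓝 r] fun _ ↦ 0 := by
      filter_upwards [isOpen_Ioi.mem_nhds (mem_Ioi.2 hr)] with x hx using hF0 hx
    exact ((c.hasDerivAt r hr hn).congr_of_eventuallyEq h1.symm).unique (hasDerivAt_const r 0)
  have key : ∀ p q : ℚ, 0 < (p : ℝ) → (p : ℝ) ≤ q → (∀ n, radius d n ∉ Icc (p : ℝ) q) →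
      ∀ᵐ x : ℝ, x ∈ Ioo (p : ℝ) q → g x = 0 := by
    intro p q hp hpq hn
    have hint := MemLp.intervalIntegrable_pos hg hp hpq
    filter_upwards [hint.ae_hasDerivAt_integral] with x hx hmem
    have hder := hx (by rw [uIcc_of_le hpq]; exact Ioo_subset_Icc_self hmem) p left_mem_uIcc
    have hz : (fun u ↦ ∫ t in (p : ℝ)..u, g t) =ᶠ[𝓝 x] fun _ ↦ 0 := by
      filter_upwards [isOpen_Ioo.mem_nhds hmem] with u hu
      have hsub : Icc (p : ℝ) u ⊆ Icc p q := Icc_subset_Icc le_rfl hu.2.le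
      have e := c.integral_eq p u hp hu.1.le fun n hmm ↦ hn n (hsub hmm)
      rw [hF' u (hp.trans hu.1) fun n hr ↦ hn n (hr ▸ ⟨hu.1.le, hu.2.le⟩),
        hF' p hp fun n hr ↦ hn n (hr ▸ ⟨le_rfl, hpq⟩), sub_zero] at e
      have e2 : ∫ s in (p : ℝ)..u, (((centrifugal α l / s ^ 2 : ℝ) : ℂ) * F s - g s)
          = ∫ s in (p : ℝ)..u, - g s := by
        refine intervalIntegral.integral_congr fun s hs ↦ ?_
        rw [uIcc_of_le hu.1.le] at hs
        have : F s = 0 := hF0 (hp.trans_le hs.1)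
        simp [this]
      rw [e2, intervalIntegral.integral_neg] at e
      exact neg_eq_zero.1 e.symm
    exact (hder.congr_of_eventuallyEq hz.symm).unique (hasDerivAt_const x 0)
  have hall : ∀ᵐ x : ℝ, ∀ p q : ℚ, 0 < (p : ℝ) → (p : ℝ) ≤ q →
      (∀ n, radius d n ∉ Icc (p : ℝ) q) → x ∈ Ioo (p : ℝ) q → g x = 0 := by
    simp only [ae_all_iff]
    exact fun p q h1 h2 h3 ↦ key p q h1 h2 h3
  have hrad : ∀ᵐ x : ℝ, x ∉ range (radius d) := (countable_range _).ae_notMem _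
  filter_upwards [ae_restrict_of_ae hall, ae_restrict_of_ae hrad,
    ae_restrict_mem measurableSet_Ioi] with x hx hxr hx0
  have hopen : Ioi (0 : ℝ) ∩ (range (radius d))ᶜ ∈ 𝓝 x :=
    (isOpen_Ioi.inter (isClosed_radii hd).isOpen_compl).mem_nhds ⟨hx0, hxr⟩
  obtain ⟨ε, hε, hball⟩ := Metric.mem_nhds_iff.1 hopen
  obtain ⟨p, hp1, hp2⟩ := exists_rat_btwn (sub_lt_self x hε)
  obtain ⟨q, hq1, hq2⟩ := exists_rat_btwn (lt_add_of_pos_right x hε)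
  have hsub : Icc (p : ℝ) q ⊆ Ioi (0 : ℝ) ∩ (range (radius d))ᶜ := fun y hy ↦ by
    refine hball ?_
    rw [Real.ball_eq_Ioo]
    exact ⟨hp1.trans_le hy.1, hy.2.trans_lt hq2⟩
  have hpq : (p : ℝ) ≤ q := (hp2.trans hq1).le
  exact hx p q (hsub ⟨le_rfl, hpq⟩).1 hpq (fun n hn ↦ (hsub hn).2 ⟨n, rfl⟩) ⟨hp2, hq1⟩

/- The Hamiltonian in the plane. -/

/-- The graph of the orthogonal sum `H_{α;β} = ⊕_l U⁻¹ H_{α;β,l} U ⊗ I_l`: it consists of the pairs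
`(f, g)` in `L²(ℝ²)` such that, for every `l`, the `l`-th partial wave of `f` is in the domain of
`H_{α;β,l}` and is mapped to the `l`-th partial wave of `g`. -/
def hamiltonianGraph (d α β : ℝ) : Submodule ℂ (PlaneL2 × PlaneL2) where
  carrier := {p | ∀ l : ℤ, RadialGraph d α β l (partialWave l p.1) (partialWave l p.2)}
  zero_mem' l := (RadialGraph.zero d α β l).congr (partialWave_zero l).symm (partialWave_zero l).symm
  add_mem' {p q} hp hq l := ((hp l).add (hq l)).congr (partialWave_add p.1 q.1 l).symm
    (partialWave_add p.2 q.2 l).symm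
  smul_mem' c p hp l := ((hp l).smul c).congr (partialWave_smul c p.1 l).symm
    (partialWave_smul c p.2 l).symm

/-- The Hamiltonian `H_{α;β}` in `L²(ℝ²)`: Aharonov–Bohm flux `α` at the origin and a `δ` interaction
of strength `β` on the circles of radii `r_n = d (n + 1/2)`. -/
def hamiltonian (d α β : ℝ) : PlaneL2 →ₗ.[ℂ] PlaneL2 := (hamiltonianGraph d α β).toLinearPMap

/-- The relation that defines the Hamiltonian is single-valued, hence is the graph of the
Hamiltonian. -/
theorem hamiltonian_graph {d : ℝ} (hd : 0 < d) (α β : ℝ) :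
    (hamiltonian d α β).graph = hamiltonianGraph d α β := by
  refine Submodule.toLinearPMap_graph_eq _ fun p hp hp0 ↦ ?_
  refine eq_zero_of_partialWave _ fun l ↦ RadialGraph.eq_zero hd ?_ (hp l)
  rw [hp0]
  exact partialWave_zero l

end AharonovBohm

end

/-!
Let `E` be the bottom of the spectrum of the Kronig–Penney operator `-d²/dr² + β ∑ₙ δ(r - rₙ)`, with
periodic positive ground state `φ`. The eigenvalues of the Hamiltonian lie in `[E, ∞)`, and every
point of `(E, ∞)` is in its spectrum; so no eigenvalue is isolated.

*Eigenvalues lie in `[E, ∞)`.* After the ground state substitution, the only obstruction to the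
radial operators being bounded below by `E` is the attractive term `(α² - 1/4) r⁻²` in the partial
wave `l = 0`. It is subcritical because `α > 0`, and Hardy's inequality with weight `φ²` still
dominates it as long as `|φ⁻² - 1| ≤ 2 α`, which holds for small `|β|` (`exists_isGroundState`). The
argument is carried out pointwise rather than with quadratic forms: the function `χ` of `riccati`
solves a Riccati equation, and for an eigenfunction `F` with eigenvalue off `[E, ∞)` a rotation
of `(F' - χ F) F̄` has monotone real part. The boundary condition or square integrability makes it
vanish at the origin (`tendsto_origin`), and square integrability excludes that it becomes positive
(`nonpos_of_growth`); hence `F = 0` (`IsRadialPair.ae_eq_zero`). Nonreal `z` are included, so that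
symmetry of the operator need not be shown separately.

*Points above `E` are spectrum.* For `λ > E` the centrifugal potential of angular momentum
`l ≈ R √(λ - E)` is nearly the constant `λ - E` on a long window around the large radius `R`, and `φ`
cut off to the window is an approximate eigenfunction at `λ` (`mem_opSpectrum_of_gt`).
-/

namespace AharonovBohm

open MeasureTheory Set Filter Topology Complex

/-! ### Ground state of the periodic comparison operator -/

/-- `φ` is a positive solution of `-φ'' + β ∑ₙ δ(r - rₙ) φ = E φ` on the half-line, with `φ'` bounded;
`dφ` is its derivative off the radii. For the `d`-periodic such `φ`, `E` is the bottom of the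
spectrum of the Kronig–Penney operator. -/
structure IsGroundState (d β E : ℝ) (φ dφ : ℝ → ℝ) : Prop where
  continuousOn : ContinuousOn φ (Ioi 0)
  pos : ∀ r, 0 < φ r
  hasDerivAt : ∀ r > 0, (∀ n, r ≠ radius d n) → HasDerivAt φ (dφ r) r
  hasDerivAt_deriv : ∀ r > 0, (∀ n, r ≠ radius d n) → HasDerivAt dφ (-E * φ r) r
  jump : ∀ n, ∃ p m : ℝ, Tendsto dφ (𝓝[>] (radius d n)) (𝓝 p) ∧
    Tendsto dφ (𝓝[<] (radius d n)) (𝓝 m) ∧ p - m = β * φ (radius d n)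
  measurable : Measurable φ
  measurable_deriv : Measurable dφ
  bounded_deriv : ∃ B, ∀ r, |dφ r| ≤ B

/-- The displacement of `r` from the nearest multiple of `d`, with values in `[-d/2, d/2)`. The radii
are the half-integer multiples of `d`, so that the cells between them are centred at the
multiples. -/
noncomputable def cellCoord (d r : ℝ) : ℝ := r - d * ⌊r / d + 1 / 2⌋

lemma measurable_cellCoord (d : ℝ) : Measurable (cellCoord d) := by
  unfold cellCoord
  have : Measurable fun r : ℝ ↦ ((⌊r / d + 1 / 2⌋ : ℤ) : ℝ) :=
    (measurable_from_top (f := fun k : ℤ ↦ (k : ℝ))).comp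
      (Int.measurable_floor.comp (by fun_prop))
  fun_prop

lemma cellCoord_eq {d : ℝ} (hd : 0 < d) {r : ℝ} {k : ℤ} (h₁ : d * (k - 1 / 2) ≤ r)
    (h₂ : r < d * (k + 1 / 2)) : cellCoord d r = r - d * k := by
  have : ⌊r / d + 1 / 2⌋ = k := by
    rw [Int.floor_eq_iff]
    constructor
    · have : (k : ℝ) - 1 / 2 ≤ r / d := by rw [le_div_iff₀ hd]; linarith
      linarith
    · have : r / d < (k : ℝ) + 1 / 2 := by rw [div_lt_iff₀ hd]; linarith
      linarith
  rw [cellCoord, this]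

lemma abs_cellCoord_le {d : ℝ} (hd : 0 < d) (r : ℝ) : |cellCoord d r| ≤ d / 2 := by
  have h1 := Int.floor_le (r / d + 1 / 2)
  have h2 := Int.lt_floor_add_one (r / d + 1 / 2)
  have h3 : d * (r / d) = r := by field_simp
  rw [cellCoord, abs_le]
  constructor <;> nlinarith

/-- Off the radii, a positive `r` lies in the interior of one of the cells. -/
lemma exists_cell {d : ℝ} (hd : 0 < d) {r : ℝ} (hr : 0 < r) (hn : ∀ n, r ≠ radius d n) :
    ∃ k : ℤ, r ∈ Ioo (d * (k - 1 / 2 : ℝ)) (d * (k + 1 / 2 : ℝ)) := by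
  have h1 := Int.floor_le (r / d + 1 / 2)
  have h2 := Int.lt_floor_add_one (r / d + 1 / 2)
  have h3 : d * (r / d) = r := by field_simp
  have h4 : 0 < r / d := by positivity
  set k := ⌊r / d + 1 / 2⌋ with hk
  refine ⟨k, lt_of_le_of_ne ?_ ?_, ?_⟩
  · nlinarith
  · intro h
    have hk1 : (0 : ℝ) < k := by
      have : r / d = k - 1 / 2 := by rw [← h]; field_simp
      have : (-1 : ℝ) < k := by linarith
      have : (-1 : ℤ) < k := by exact_mod_cast this
      have h0 : k ≠ 0 := by
        intro h0
        rw [h0] at h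
        norm_num at h
        nlinarith
      have : 0 < k := by omega
      exact_mod_cast this
    have hk2 : 0 < k := by exact_mod_cast hk1
    obtain ⟨m, hm⟩ := Int.eq_succ_of_zero_lt hk2
    refine hn m ?_
    rw [← h, radius, hm]
    push_cast
    ring
  · nlinarith

/-- A positive even solution on one cell, with derivative at the cell boundary adapted to `β`, extends
periodically to a ground state. -/
lemma isGroundState_of_cell {d β E : ℝ} (hd : 0 < d) {C C' : ℝ → ℝ}
    (heven : ∀ x, C (-x) = C x) (hodd : ∀ x, C' (-x) = -C' x)
    (hC : ∀ x, HasDerivAt C (C' x) x) (hC' : ∀ x, HasDerivAt C' (-E * C x) x)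
    (hβ : -2 * C' (d / 2) = β * C (d / 2)) (hpos : ∀ x, |x| ≤ d / 2 → 0 < C x) :
    IsGroundState d β E (fun r ↦ C (cellCoord d r)) (fun r ↦ C' (cellCoord d r)) := by
  have hCc : Continuous C := continuous_iff_continuousAt.2 fun x ↦ (hC x).continuousAt
  have hCc' : Continuous C' := continuous_iff_continuousAt.2 fun x ↦ (hC' x).continuousAt
  have hev : ∀ {r : ℝ} {k : ℤ}, r ∈ Ioo (d * (k - 1 / 2 : ℝ)) (d * (k + 1 / 2 : ℝ)) →
      cellCoord d =ᶠ[𝓝 r] fun s ↦ s - d * k := fun {r k} hk ↦ by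
    filter_upwards [isOpen_Ioo.mem_nhds hk] with s hs using cellCoord_eq hd hs.1.le hs.2
  have hτ : ∀ r > 0, (∀ n, r ≠ radius d n) → HasDerivAt (cellCoord d) 1 r := by
    intro r hr hn
    obtain ⟨k, hk⟩ := exists_cell hd hr hn
    exact ((hasDerivAt_id r).sub_const (d * k)).congr_of_eventuallyEq (hev hk)
  have hD : ∀ r > 0, (∀ n, r ≠ radius d n) →
      HasDerivAt (fun r ↦ C (cellCoord d r)) (C' (cellCoord d r)) r := fun r hr hn ↦ by
    simpa [Function.comp_def] using (hC (cellCoord d r)).comp r (hτ r hr hn)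
  have hright : ∀ n : ℕ, cellCoord d =ᶠ[𝓝[≥] (radius d n)] fun s ↦ s - d * (n + 1) := by
    intro n
    have : Ico (radius d n) (radius d n + d) ∈ 𝓝[≥] (radius d n) :=
      Ico_mem_nhdsGE (by linarith)
    filter_upwards [this] with s hs
    rw [cellCoord_eq hd (k := n + 1)]
    · push_cast; ring
    · have := hs.1
      rw [radius] at this
      push_cast
      linarith
    · have := hs.2
      rw [radius] at this
      push_cast
      linarith
  have hleft : ∀ n : ℕ, cellCoord d =ᶠ[𝓝[<] (radius d n)] fun s ↦ s - d * n := by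
    intro n
    have : Ioo (radius d n - d) (radius d n) ∈ 𝓝[<] (radius d n) :=
      Ioo_mem_nhdsLT (by linarith)
    filter_upwards [this] with s hs
    rw [cellCoord_eq hd (k := n)]
    · push_cast; ring
    · have := hs.1
      rw [radius] at this
      push_cast
      linarith
    · have := hs.2
      rw [radius] at this
      push_cast
      linarith
  have hrt : ∀ n : ℕ, Tendsto (cellCoord d) (𝓝[≥] (radius d n)) (𝓝 (-(d / 2))) := by
    intro n
    refine Tendsto.congr' (hright n).symm ?_
    have : Continuous fun s : ℝ ↦ s - d * (n + 1) := by fun_prop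
    have h := this.continuousWithinAt (s := Ici (radius d n)) (x := radius d n)
    have e : radius d n - d * (n + 1) = -(d / 2) := by rw [radius]; ring
    rw [ContinuousWithinAt, e] at h
    exact h
  have hlt : ∀ n : ℕ, Tendsto (cellCoord d) (𝓝[<] (radius d n)) (𝓝 (d / 2)) := by
    intro n
    refine Tendsto.congr' (hleft n).symm ?_
    have : Continuous fun s : ℝ ↦ s - d * n := by fun_prop
    have h := this.continuousWithinAt (s := Iio (radius d n)) (x := radius d n)
    have e : radius d n - d * n = d / 2 := by rw [radius]; ring
    rw [ContinuousWithinAt, e] at h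
    exact h
  have hval : ∀ n : ℕ, cellCoord d (radius d n) = -(d / 2) := by
    intro n
    rw [(hright n).eq_of_nhdsWithin (mem_Ici.2 le_rfl), radius]
    ring
  refine ⟨?_, fun r ↦ hpos _ (abs_cellCoord_le hd r), hD, ?_, ?_,
    hCc.measurable.comp (measurable_cellCoord d), hCc'.measurable.comp (measurable_cellCoord d), ?_⟩
  · intro r hr
    refine ContinuousAt.continuousWithinAt ?_
    by_cases hn : ∀ n, r ≠ radius d n
    · exact (hD r hr hn).continuousAt
    · push Not at hn
      obtain ⟨n, rfl⟩ := hn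
      rw [continuousAt_iff_continuous_left'_right']
      constructor
      · have h := (hCc.tendsto (d / 2)).comp (hlt n)
        simp only [ContinuousWithinAt, hval, heven]
        exact h
      · have h := (hCc.tendsto (-(d / 2))).comp
          ((hrt n).mono_left (nhdsWithin_mono _ Ioi_subset_Ici_self))
        simp only [ContinuousWithinAt, hval]
        exact h
  · intro r hr hn
    simpa [Function.comp_def] using (hC' (cellCoord d r)).comp r (hτ r hr hn)
  · intro n
    refine ⟨C' (-(d / 2)), C' (d / 2), ?_, (hCc'.tendsto _).comp (hlt n), ?_⟩
    · exact (hCc'.tendsto _).comp ((hrt n).mono_left (nhdsWithin_mono _ Ioi_subset_Ici_self))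
    · rw [hval, heven, hodd, ← hβ]
      ring
  · obtain ⟨B, hB⟩ := isCompact_Icc.exists_bound_of_continuousOn
      (hCc'.continuousOn (s := Icc (-(d / 2)) (d / 2)))
    exact ⟨B, fun r ↦ hB _ (abs_le.1 (abs_cellCoord_le hd r))⟩

/-- For small `|β|` there is a ground state uniformly close to `1`. On a cell it is `cos (k x)` with
`k tan (k d / 2) = β / 2` if `β ≥ 0`, and `cosh (k x)` with `-k tanh (k d / 2) = β / 2` if
`β ≤ 0`. -/
lemma exists_isGroundState {d : ℝ} (hd : 0 < d) {ε : ℝ} (hε : 0 < ε) :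
    ∃ β₀ > 0, ∀ β : ℝ, |β| < β₀ → ∃ (E : ℝ) (φ dφ : ℝ → ℝ), IsGroundState d β E φ dφ ∧
      ∀ r, |(φ r ^ 2)⁻¹ - 1| ≤ ε := by
  have hcos : ∀ᶠ y in 𝓝 (0 : ℝ), 0 < Real.cos y ∧ |(Real.cos y ^ 2)⁻¹ - 1| < ε := by
    have h1 : ContinuousAt Real.cos 0 := Real.continuous_cos.continuousAt
    have h2 : ContinuousAt (fun y ↦ |(Real.cos y ^ 2)⁻¹ - 1|) 0 :=
      (((h1.pow 2).inv₀ (by simp)).sub continuousAt_const).abs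
    exact (h1.eventually (lt_mem_nhds (by simp))).and
      (h2.eventually (gt_mem_nhds (by simpa using hε)))
  have hcosh : ∀ᶠ y in 𝓝 (0 : ℝ), |(Real.cosh y ^ 2)⁻¹ - 1| < ε := by
    have h1 : ContinuousAt Real.cosh 0 := Real.continuous_cosh.continuousAt
    have h2 : ContinuousAt (fun y ↦ |(Real.cosh y ^ 2)⁻¹ - 1|) 0 :=
      (((h1.pow 2).inv₀ (by simp)).sub continuousAt_const).abs
    exact h2.eventually (gt_mem_nhds (by simpa using hε))
  obtain ⟨η', hη', hball⟩ := Metric.eventually_nhds_iff_ball.1 (hcos.and hcosh)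
  obtain ⟨η, hη, hη1, hη2⟩ : ∃ η > 0, η < η' ∧ η < Real.pi :=
    ⟨min η' Real.pi / 2, by have := Real.pi_pos; positivity,
      by have := min_le_left η' Real.pi; have := lt_min hη' Real.pi_pos; linarith,
      by have := min_le_right η' Real.pi; have := lt_min hη' Real.pi_pos; linarith⟩
  set δ := 2 * η / d with hδ
  have hδ0 : 0 < δ := by positivity
  have hδd : δ * (d / 2) = η := by rw [hδ]; field_simp
  have hsin : 0 < Real.sin η := Real.sin_pos_of_pos_of_lt_pi hη hη2
  have hsinh : 0 < Real.sinh η := Real.sinh_pos_iff.2 hη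
  have hcη := Real.cosh_pos η
  have hmem : ∀ k ∈ Icc 0 δ, ∀ x, |x| ≤ d / 2 → k * x ∈ Metric.ball (0 : ℝ) η' := by
    intro k hk x hx
    rw [mem_ball_zero_iff, Real.norm_eq_abs, abs_mul, abs_of_nonneg hk.1]
    calc k * |x| ≤ δ * (d / 2) := by
          have := hk.2
          gcongr
      _ < η' := by rw [hδd]; exact hη1
  refine ⟨min (2 * δ * Real.sin η) (2 * δ * Real.sinh η / Real.cosh η), by positivity,
    fun β hβ ↦ ?_⟩
  rw [lt_min_iff] at hβ
  rcases le_total 0 β with h0 | h0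
  · rw [abs_of_nonneg h0] at hβ
    have hc : ContinuousOn (fun k ↦ 2 * k * Real.sin (k * (d / 2)) - β * Real.cos (k * (d / 2)))
        (Icc 0 δ) := by fun_prop
    have hiv := intermediate_value_Icc hδ0.le hc
    have h00 : (0 : ℝ) ∈ Icc (2 * 0 * Real.sin (0 * (d / 2)) - β * Real.cos (0 * (d / 2)))
        (2 * δ * Real.sin (δ * (d / 2)) - β * Real.cos (δ * (d / 2))) := by
      rw [hδd]
      constructor
      · simpa using h0
      · nlinarith [Real.cos_le_one η]
    obtain ⟨k, hk, hk0⟩ := hiv h00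
    simp only at hk0
    refine ⟨k ^ 2, _, _, isGroundState_of_cell (C := fun x ↦ Real.cos (k * x))
      (C' := fun x ↦ -k * Real.sin (k * x)) hd ?_ ?_ ?_ ?_ ?_ ?_, ?_⟩
    · intro x; simp
    · intro x; simp
    · intro x
      have := ((hasDerivAt_id x).const_mul k).cos
      simpa [mul_comm] using this
    · intro x
      have := (((hasDerivAt_id x).const_mul k).sin).const_mul (-k)
      exact this.congr_deriv (by simp only [id]; ring)
    · linarith
    · exact fun x hx ↦ (hball _ (hmem k hk x hx)).1.1
    · exact fun r ↦ (hball _ (hmem k hk _ (abs_cellCoord_le hd r))).1.2.le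
  · rw [abs_of_nonpos h0] at hβ
    have hc : ContinuousOn (fun k ↦ 2 * k * Real.sinh (k * (d / 2)) + β * Real.cosh (k * (d / 2)))
        (Icc 0 δ) := by fun_prop
    have hiv := intermediate_value_Icc hδ0.le hc
    have h00 : (0 : ℝ) ∈ Icc (2 * 0 * Real.sinh (0 * (d / 2)) + β * Real.cosh (0 * (d / 2)))
        (2 * δ * Real.sinh (δ * (d / 2)) + β * Real.cosh (δ * (d / 2))) := by
      rw [hδd]
      constructor
      · simpa using h0
      · have := hβ.2
        rw [lt_div_iff₀ hcη] at this
        linarith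
    obtain ⟨k, hk, hk0⟩ := hiv h00
    simp only at hk0
    refine ⟨-k ^ 2, _, _, isGroundState_of_cell (C := fun x ↦ Real.cosh (k * x))
      (C' := fun x ↦ k * Real.sinh (k * x)) hd ?_ ?_ ?_ ?_ ?_ ?_, ?_⟩
    · intro x; simp
    · intro x; simp
    · intro x
      have := ((hasDerivAt_id x).const_mul k).cosh
      simpa [mul_comm] using this
    · intro x
      have := (((hasDerivAt_id x).const_mul k).sinh).const_mul k
      exact this.congr_deriv (by simp only [id]; ring)
    · linarith
    · exact fun x _ ↦ Real.cosh_pos _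
    · exact fun r ↦ (hball _ (hmem k hk _ (abs_cellCoord_le hd r))).2.le

/-! ### Behaviour of radial solutions at the origin -/

lemma hasDerivAt_ofReal_rpow {r : ℝ} (hr : 0 < r) (a : ℝ) :
    HasDerivAt (fun s : ℝ ↦ ((s ^ a : ℝ) : ℂ)) ((a * r ^ (a - 1) : ℝ) : ℂ) r :=
  (Real.hasDerivAt_rpow_const (Or.inl hr.ne')).ofReal_comp

lemma tendsto_rpow_nhdsGT_zero {a : ℝ} (ha : 0 < a) :
    Tendsto (fun r : ℝ ↦ r ^ a) (𝓝[>] 0) (𝓝 0) := by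
  have h := (Real.continuousAt_rpow_const 0 a (Or.inr ha.le)).tendsto
  rw [Real.zero_rpow ha.ne'] at h
  exact h.mono_left nhdsWithin_le_nhds

/-- The hypothesis on `w` is the equation satisfied by the Wronskian `ψ F' - ψ' F` of a square
integrable solution `F` with the zero energy solution `ψ(r) = r^{1/2+ν}`. -/
lemma tendsto_wronskian_origin {ν δ N : ℝ} (hν : 0 < ν) (hδ : 0 < δ) {F w : ℝ → ℂ} {z : ℂ}
    (hF : ContinuousOn F (Ioo 0 δ)) (hint : IntegrableOn (fun r ↦ ‖F r‖ ^ 2) (Ioi 0))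
    (hN : ∫ r in Ioi 0, ‖F r‖ ^ 2 = N)
    (hw : ∀ r ∈ Ioo 0 δ, HasDerivAt w (-z * ((r ^ (1 / 2 + ν) : ℝ) : ℂ) * F r) r) :
    ∃ w₀, Tendsto w (𝓝[>] 0) (𝓝 w₀) ∧
      ∀ r ∈ Ioo 0 δ, ‖w r - w₀‖ ≤ ‖z‖ * (N + 1) / 2 * r ^ (1 + ν) := by
  have hN0 : 0 ≤ N := hN ▸ integral_nonneg fun _ ↦ by positivity
  have key : ∀ a b, 0 < a → a ≤ b → b < δ →
      ‖w b - w a‖ ≤ ‖z‖ * (N + 1) / 2 * b ^ (1 + ν) := by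
    intro a b ha hab hb
    have hb0 : 0 < b := ha.trans_le hab
    have hsub : Icc a b ⊆ Ioo 0 δ := fun x hx ↦ ⟨ha.trans_le hx.1, hx.2.trans_lt hb⟩
    have hcont : ContinuousOn (fun r : ℝ ↦ -z * ((r ^ (1 / 2 + ν) : ℝ) : ℂ) * F r) (Icc a b) := by
      refine ContinuousOn.mul (continuousOn_const.mul ?_) (hF.mono hsub)
      exact (Complex.continuous_ofReal.comp
        (Real.continuous_rpow_const (by positivity))).continuousOn
    rw [← intervalIntegral.integral_eq_sub_of_hasDerivAt (f := w)
      (f' := fun r ↦ -z * ((r ^ (1 / 2 + ν) : ℝ) : ℂ) * F r)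
      (fun x hx ↦ hw x (hsub (by rwa [uIcc_of_le hab] at hx)))
      (ContinuousOn.intervalIntegrable (by rwa [uIcc_of_le hab]))]
    set t := b ^ (1 / 2 : ℝ) with ht
    have ht0 : 0 < t := Real.rpow_pos_of_pos hb0 _
    have htt : t * t = b := by rw [ht, ← Real.rpow_add hb0]; norm_num
    have hsq : IntegrableOn (fun r ↦ ‖F r‖ ^ 2) (Ioc a b) :=
      hint.mono_set fun x hx ↦ ha.trans hx.1
    -- `2 |F| ≤ t |F|² + t⁻¹` with `t = √b` replaces the Cauchy-Schwarz inequality.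
    have hbd : ∀ r ∈ Ioc a b, ‖-z * ((r ^ (1 / 2 + ν) : ℝ) : ℂ) * F r‖ ≤
        ‖z‖ * b ^ (1 / 2 + ν) * ((t * ‖F r‖ ^ 2 + t⁻¹) / 2) := by
      intro r hr
      have hr0 : 0 < r := ha.trans hr.1
      rw [norm_mul, norm_mul, norm_neg, Complex.norm_real, Real.norm_of_nonneg (by positivity)]
      have h1 : r ^ (1 / 2 + ν) ≤ b ^ (1 / 2 + ν) :=
        Real.rpow_le_rpow hr0.le hr.2 (by positivity)
      have h2 : ‖F r‖ ≤ (t * ‖F r‖ ^ 2 + t⁻¹) / 2 := by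
        have h3 : 0 ≤ t⁻¹ * (t * ‖F r‖ - 1) ^ 2 := by positivity
        have h4 : t⁻¹ * (t * ‖F r‖ - 1) ^ 2 = t * ‖F r‖ ^ 2 - 2 * ‖F r‖ + t⁻¹ := by
          field_simp
          ring
        linarith
      gcongr
    rw [intervalIntegral.integral_of_le hab]
    have hmaj : IntegrableOn (fun r ↦ ‖z‖ * b ^ (1 / 2 + ν) * ((t * ‖F r‖ ^ 2 + t⁻¹) / 2))
        (Ioc a b) :=
      (((hsq.const_mul t).add (integrableOn_const (by simp))).div_const 2).const_mul _
    refine (norm_integral_le_of_norm_le hmaj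
      ((ae_restrict_iff' measurableSet_Ioc).2 (ae_of_all _ hbd))).trans ?_
    rw [integral_const_mul, integral_div, integral_add (hsq.const_mul t)
      (integrableOn_const (by simp)), integral_const_mul]
    simp only [integral_const, MeasurableSet.univ, measureReal_restrict_apply, univ_inter,
      Real.volume_real_Ioc_of_le hab, smul_eq_mul]
    have h5 : ∫ r in Ioc a b, ‖F r‖ ^ 2 ≤ N := by
      rw [← hN]
      exact setIntegral_mono_set hint (ae_of_all _ fun _ ↦ by positivity)
        (ae_of_all _ fun x hx ↦ ha.trans hx.1)
    have h6 : (b - a) * t⁻¹ ≤ t := by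
      rw [← div_eq_mul_inv, div_le_iff₀ ht0, htt]
      linarith
    have h7 : b ^ (1 + ν) = b ^ (1 / 2 + ν) * t := by
      rw [ht, ← Real.rpow_add hb0]; ring_nf
    rw [h7]
    calc ‖z‖ * b ^ (1 / 2 + ν) * (((t * ∫ r in Ioc a b, ‖F r‖ ^ 2) + (b - a) * t⁻¹) / 2)
        ≤ ‖z‖ * b ^ (1 / 2 + ν) * ((t * N + t) / 2) := by gcongr
      _ = _ := by ring
  have hlim : Tendsto (fun r : ℝ ↦ ‖z‖ * (N + 1) / 2 * r ^ (1 + ν)) (𝓝[>] 0) (𝓝 0) := by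
    simpa using (tendsto_rpow_nhdsGT_zero (a := 1 + ν) (by positivity)).const_mul
      (‖z‖ * (N + 1) / 2)
  obtain ⟨w₀, hw₀⟩ : ∃ w₀, Tendsto w (𝓝[>] 0) (𝓝 w₀) := by
    rw [← cauchy_map_iff_exists_tendsto, Metric.cauchy_iff]
    refine ⟨inferInstance, fun ε hε ↦ ?_⟩
    have hev := (hlim.eventually (gt_mem_nhds (half_pos hε))).and (Ioo_mem_nhdsGT hδ)
    refine ⟨_, image_mem_map hev, ?_⟩
    rintro _ ⟨x, hx, rfl⟩ _ ⟨y, hy, rfl⟩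
    rcases le_total x y with h | h
    · rw [dist_comm, dist_eq_norm]
      linarith [key x y hx.2.1 h hy.2.2, hy.1]
    · rw [dist_eq_norm]
      linarith [key y x hy.2.1 h hx.2.2, hx.1]
  refine ⟨w₀, hw₀, fun r hr ↦ ?_⟩
  refine le_of_tendsto (hw₀.const_sub (w r)).norm ?_
  filter_upwards [Ioo_mem_nhdsGT hr.1] with a ha
  exact key a r ha.1 ha.2.le hr.2

/-- A square integrable solution of `-F'' + (ν² - 1/4) r⁻² F = z F` near the origin, subject to the
boundary condition in the limit circle case `ν < 1`, satisfies `|F|² = o(r)` and `F' F̄ → 0`.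

The Wronskian `w` with `r^{1/2+ν}` has a limit `w₀` at the origin, at rate `r^{1+ν}`, and
`(r^{-1/2-ν} F)' = r^{-1-2ν} w`. Hence `r^{ν-1/2} F → -w₀/(2ν)`, so that `w₀ = 0`, by the boundary
condition if `ν < 1` and because `r^{-1/2} ∉ L²` if `ν ≥ 1`. -/
lemma tendsto_origin {ν δ : ℝ} (hν : 0 < ν) (hδ : 0 < δ) {F dF : ℝ → ℂ} {z : ℂ}
    (hF : ∀ r ∈ Ioo 0 δ, HasDerivAt F (dF r) r)
    (hdF : ∀ r ∈ Ioo 0 δ,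
      HasDerivAt dF ((((-1 / 4 + ν ^ 2) / r ^ 2 : ℝ) : ℂ) * F r - z * F r) r)
    (hint : IntegrableOn (fun r ↦ ‖F r‖ ^ 2) (Ioi 0))
    (hbc : ν < 1 → Tendsto (fun r : ℝ ↦ ((r ^ (ν - 1 / 2) : ℝ) : ℂ) * F r) (𝓝[>] 0) (𝓝 0)) :
    Tendsto (fun r ↦ ‖F r‖ ^ 2 / r) (𝓝[>] 0) (𝓝 0) ∧
      Tendsto (fun r ↦ dF r * starRingEnd ℂ (F r)) (𝓝[>] 0) (𝓝 0) := by
  set w : ℝ → ℂ := fun r ↦ ((r ^ (1 / 2 + ν) : ℝ) : ℂ) * dF r -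
    (((1 / 2 + ν) * r ^ (1 / 2 + ν - 1) : ℝ) : ℂ) * F r with hw
  have hFc : ContinuousOn F (Ioo 0 δ) := fun r hr ↦ (hF r hr).continuousAt.continuousWithinAt
  have hwd : ∀ r ∈ Ioo 0 δ, HasDerivAt w (-z * ((r ^ (1 / 2 + ν) : ℝ) : ℂ) * F r) r := by
    intro r hr
    have hr0 : 0 < r := hr.1
    have h1 := (hasDerivAt_ofReal_rpow hr0 (1 / 2 + ν)).mul (hdF r hr)
    have h2 : HasDerivAt (fun s : ℝ ↦ (((1 / 2 + ν) * s ^ (1 / 2 + ν - 1) : ℝ) : ℂ))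
        (((1 / 2 + ν) * ((1 / 2 + ν - 1) * r ^ (1 / 2 + ν - 1 - 1)) : ℝ) : ℂ) r :=
      ((Real.hasDerivAt_rpow_const (Or.inl hr0.ne')).const_mul (1 / 2 + ν)).ofReal_comp
    refine (h1.sub (h2.mul (hF r hr))).congr_deriv ?_
    have e1 : r ^ (1 / 2 + ν) = r ^ (1 / 2 + ν - 1 - 1) * r ^ 2 := by
      rw [← Real.rpow_natCast, ← Real.rpow_add hr0]; congr 1; push_cast; ring
    rw [e1]
    have : (r : ℂ) ≠ 0 := by exact_mod_cast hr0.ne'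
    push_cast
    field_simp
    ring
  obtain ⟨w₀, hwlim, hwb⟩ := tendsto_wronskian_origin hν hδ hFc hint rfl hwd
  set C := ‖z‖ * ((∫ r in Ioi 0, ‖F r‖ ^ 2) + 1) / 2 with hC
  have hC0 : 0 ≤ C := by
    have : 0 ≤ ∫ r in Ioi 0, ‖F r‖ ^ 2 := integral_nonneg fun _ ↦ by positivity
    positivity
  set k : ℝ → ℂ := fun r ↦ ((r ^ (-(1 / 2 + ν)) : ℝ) : ℂ) * F r +
    w₀ / (2 * ν) * ((r ^ (-(2 * ν)) : ℝ) : ℂ) with hk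
  have hνC : (ν : ℂ) ≠ 0 := by exact_mod_cast hν.ne'
  have hkd : ∀ r ∈ Ioo 0 δ,
      HasDerivAt k (((r ^ (-1 - 2 * ν) : ℝ) : ℂ) * (w r - w₀)) r := by
    intro r hr
    have hr0 : 0 < r := hr.1
    have h1 := (hasDerivAt_ofReal_rpow hr0 (-(1 / 2 + ν))).mul (hF r hr)
    have h2 := (hasDerivAt_ofReal_rpow hr0 (-(2 * ν))).const_mul (w₀ / (2 * ν))
    refine (h1.add h2).congr_deriv ?_
    have e1 : r ^ (-(1 / 2 + ν)) = r ^ (-1 - 2 * ν) * r ^ (1 / 2 + ν) := by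
      rw [← Real.rpow_add hr0]; congr 1; ring
    have e2 : r ^ (-(1 / 2 + ν) - 1) = r ^ (-1 - 2 * ν) * r ^ (1 / 2 + ν - 1) := by
      rw [← Real.rpow_add hr0]; congr 1; ring
    have e3 : -(2 * ν) - 1 = -1 - 2 * ν := by ring
    rw [e1, e2, e3, hw]
    push_cast
    field_simp
    ring
  -- Any exponent with `ν - 1 ≤ κ < ν` and `0 < κ` would do.
  obtain ⟨κ, hκ0, hκν, hκ1⟩ : ∃ κ : ℝ, 0 < κ ∧ κ < ν ∧ ν - 1 ≤ κ :=
    ⟨max (ν / 2) (ν - 1 / 2), lt_max_of_lt_left (by positivity),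
      max_lt (by linarith) (by linarith), le_max_of_le_right (by linarith)⟩
  obtain ⟨η, hη0, hηδ, hη1⟩ : ∃ η, 0 < η ∧ η < δ ∧ η ≤ 1 :=
    ⟨min (δ / 2) 1, by positivity, (min_le_left _ _).trans_lt (by linarith), min_le_right _ _⟩
  -- Integration of `|k'| ≤ C r^{-ν} ≤ C r^{-1-κ}` from `η` down to `r`.
  have hkb : ∀ r ∈ Ioo 0 η, ‖k r‖ ≤ ‖k η‖ + C / κ * r ^ (-κ) := by
    intro r hr
    have hsub : Icc r η ⊆ Ioo 0 δ := fun x hx ↦ ⟨hr.1.trans_le hx.1, hx.2.trans_lt hηδ⟩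
    have h := image_norm_le_of_norm_deriv_right_le_deriv_boundary' (f := fun x ↦ k x - k r)
      (a := r) (b := η) (f' := fun x ↦ ((x ^ (-1 - 2 * ν) : ℝ) : ℂ) * (w x - w₀))
      (B := fun x ↦ C / κ * (r ^ (-κ) - x ^ (-κ))) (B' := fun x ↦ C * x ^ (-κ - 1))
      (fun x hx ↦ ((hkd x (hsub hx)).sub_const (k r)).continuousAt.continuousWithinAt)
      (fun x hx ↦ ((hkd x (hsub (Ico_subset_Icc_self hx))).sub_const (k r)).hasDerivWithinAt)
      (by simp) ?_ ?_ ?_ (x := η) (right_mem_Icc.2 hr.2.le)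
    · have h3 : 0 ≤ C / κ * η ^ (-κ) := by positivity
      have h4 : ‖k r‖ ≤ ‖k η‖ + ‖k η - k r‖ := by
        rw [norm_sub_rev]; exact norm_le_insert' _ _
      linarith
    · intro x hx
      have hx0 : 0 < x := (hsub hx).1
      exact (continuousAt_const.mul (continuousAt_const.sub
        (Real.continuousAt_rpow_const x (-κ) (Or.inl hx0.ne')))).continuousWithinAt
    · intro x hx
      have hx0 : 0 < x := hr.1.trans_le hx.1
      refine HasDerivAt.hasDerivWithinAt ?_
      refine (((Real.hasDerivAt_rpow_const (p := -κ) (Or.inl hx0.ne')).const_sub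
        (r ^ (-κ))).const_mul (C / κ)).congr_deriv ?_
      field_simp
    · intro x hx
      have hx0 : 0 < x := hr.1.trans_le hx.1
      have hx1 : x ≤ 1 := hx.2.le.trans hη1
      rw [norm_mul, Complex.norm_real, Real.norm_of_nonneg (by positivity)]
      calc x ^ (-1 - 2 * ν) * ‖w x - w₀‖ ≤ x ^ (-1 - 2 * ν) * (C * x ^ (1 + ν)) := by
            have := hwb x (hsub (Ico_subset_Icc_self hx))
            gcongr
        _ = C * x ^ (-ν) := by
            rw [mul_left_comm, ← Real.rpow_add hx0]; congr 2; ring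
        _ ≤ C * x ^ (-κ - 1) := by
            refine mul_le_mul_of_nonneg_left ?_ hC0
            exact Real.rpow_le_rpow_of_exponent_ge hx0 hx1 (by linarith)
  have hklim : ∀ μ, κ < μ → Tendsto (fun r : ℝ ↦ ((r ^ μ : ℝ) : ℂ) * k r) (𝓝[>] 0) (𝓝 0) := by
    intro μ hμ
    have h1 : Tendsto (fun r : ℝ ↦ r ^ μ * ‖k η‖ + C / κ * r ^ (μ - κ)) (𝓝[>] 0) (𝓝 0) := by
      have := ((tendsto_rpow_nhdsGT_zero (hκ0.trans hμ)).mul_const ‖k η‖).add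
        ((tendsto_rpow_nhdsGT_zero (sub_pos.2 hμ)).const_mul (C / κ))
      simpa using this
    refine squeeze_zero_norm' ?_ h1
    filter_upwards [Ioo_mem_nhdsGT hη0] with r hr
    have hr0 : 0 < r := hr.1
    rw [norm_mul, Complex.norm_real, Real.norm_of_nonneg (by positivity)]
    calc r ^ μ * ‖k r‖ ≤ r ^ μ * (‖k η‖ + C / κ * r ^ (-κ)) := by
          have := hkb r hr
          gcongr
      _ = _ := by
          rw [sub_eq_add_neg, Real.rpow_add hr0]; ring
  have hFlim : Tendsto (fun r : ℝ ↦ ((r ^ (ν - 1 / 2) : ℝ) : ℂ) * F r) (𝓝[>] 0)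
      (𝓝 (-(w₀ / (2 * ν)))) := by
    have h1 := (hklim (2 * ν) (by linarith)).sub_const (w₀ / (2 * ν))
    rw [zero_sub] at h1
    refine h1.congr' ?_
    filter_upwards [self_mem_nhdsWithin] with r hr
    have hr0 : 0 < r := hr
    have e1 : r ^ (ν - 1 / 2) = r ^ (2 * ν) * r ^ (-(1 / 2 + ν)) := by
      rw [← Real.rpow_add hr0]; congr 1; ring
    have e2 : ((r ^ (2 * ν) : ℝ) : ℂ) * ((r ^ (-(2 * ν)) : ℝ) : ℂ) = 1 := by
      rw [← Complex.ofReal_mul, ← Real.rpow_add hr0]; simp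
    rw [hk, e1]
    push_cast
    linear_combination (w₀ / (2 * ν)) * e2
  have hw₀ : w₀ = 0 := by
    suffices h : w₀ / (2 * ν) = 0 by simpa [hνC] using h
    rcases lt_or_ge ν 1 with h1 | h1
    · exact neg_eq_zero.1 (tendsto_nhds_unique hFlim (hbc h1))
    · by_contra hne
      set c := ‖-(w₀ / (2 * ν))‖ / 2 with hc
      have hpos : 0 < ‖-(w₀ / (2 * ν))‖ := norm_pos_iff.2 (neg_ne_zero.2 hne)
      have hc0 : 0 < c := by positivity
      have hev := hFlim.norm.eventually (lt_mem_nhds (show c < ‖-(w₀ / (2 * ν))‖ by linarith))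
      obtain ⟨ε, hε0, hε⟩ := (mem_nhdsGT_iff_exists_Ioc_subset).1
        (hev.and (Ioo_mem_nhdsGT hη0))
      have hε0 : 0 < ε := hε0
      have hi : IntervalIntegrable (fun x : ℝ ↦ x⁻¹) volume 0 ε := by
        rw [intervalIntegrable_iff_integrableOn_Ioc_of_le hε0.le]
        have h2 : IntegrableOn (fun r ↦ (c ^ 2)⁻¹ * ‖F r‖ ^ 2) (Ioc 0 ε) :=
          (hint.mono_set fun x hx ↦ hx.1).const_mul _
        refine Integrable.mono' h2 measurable_inv.aestronglyMeasurable ?_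
        refine (ae_restrict_iff' measurableSet_Ioc).2 (ae_of_all _ fun x hx ↦ ?_)
        have hx0 : 0 < x := hx.1
        obtain ⟨h3, h4⟩ := hε hx
        have hx1 : x ≤ 1 := h4.2.le.trans hη1
        simp only [norm_mul, Complex.norm_real] at h3
        rw [Real.norm_of_nonneg (by positivity)] at h3
        rw [Real.norm_of_nonneg (by positivity), inv_mul_eq_div, le_div_iff₀ (by positivity),
          inv_mul_le_iff₀ hx0]
        have h5 : x ^ (ν - 1 / 2) ≤ x ^ (1 / 2 : ℝ) :=
          Real.rpow_le_rpow_of_exponent_ge hx0 hx1 (by linarith)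
        have h6 : c ≤ x ^ (1 / 2 : ℝ) * ‖F x‖ := h3.le.trans (by gcongr)
        have h7 : (x ^ (1 / 2 : ℝ)) ^ 2 = x := by
          rw [← Real.rpow_natCast, ← Real.rpow_mul hx0.le]; norm_num
        calc c ^ 2 ≤ (x ^ (1 / 2 : ℝ) * ‖F x‖) ^ 2 := by gcongr
          _ = x * ‖F x‖ ^ 2 := by rw [mul_pow, h7]
      rw [intervalIntegrable_inv_iff] at hi
      rcases hi with h | h
      · exact hε0.ne h
      · exact h left_mem_uIcc
  have hkF : ∀ r, 0 < r → ‖((r ^ ν : ℝ) : ℂ) * k r‖ = r ^ (-(1 / 2 : ℝ)) * ‖F r‖ := by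
    intro r hr0
    have e1 : r ^ (-(1 / 2 : ℝ)) = r ^ ν * r ^ (-(1 / 2 + ν)) := by
      rw [← Real.rpow_add hr0]; congr 1; ring
    rw [hk, e1, hw₀]
    simp only [zero_div, zero_mul, add_zero, norm_mul, Complex.norm_real]
    rw [Real.norm_of_nonneg (by positivity), Real.norm_of_nonneg (by positivity)]
    ring
  have hhalf : Tendsto (fun r : ℝ ↦ r ^ (-(1 / 2 : ℝ)) * ‖F r‖) (𝓝[>] 0) (𝓝 0) := by
    have h1 := (hklim ν hκν).norm
    rw [norm_zero] at h1
    refine h1.congr' ?_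
    filter_upwards [self_mem_nhdsWithin] with r hr using hkF r hr
  have hsq : Tendsto (fun r ↦ ‖F r‖ ^ 2 / r) (𝓝[>] 0) (𝓝 0) := by
    have h1 := hhalf.pow 2
    rw [zero_pow two_ne_zero] at h1
    refine h1.congr' ?_
    filter_upwards [self_mem_nhdsWithin] with r hr
    have hr0 : 0 < r := hr
    rw [mul_pow, ← Real.rpow_natCast, ← Real.rpow_mul hr0.le]
    norm_num
    rw [Real.rpow_neg_one]
    ring
  refine ⟨hsq, ?_⟩
  have h2 : Tendsto (fun r : ℝ ↦ C * r * (r ^ (-(1 / 2 : ℝ)) * ‖F r‖) +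
      (1 / 2 + ν) * (‖F r‖ ^ 2 / r)) (𝓝[>] 0) (𝓝 0) := by
    have h3 : Tendsto (fun r : ℝ ↦ C * r) (𝓝[>] 0) (𝓝 0) := by
      have : Tendsto (fun r : ℝ ↦ C * r) (𝓝 0) (𝓝 (C * 0)) := by
        exact (continuous_const.mul continuous_id).tendsto 0
      rw [mul_zero] at this
      exact this.mono_left nhdsWithin_le_nhds
    simpa using (h3.mul hhalf).add (hsq.const_mul (1 / 2 + ν))
  refine squeeze_zero_norm' ?_ h2
  filter_upwards [Ioo_mem_nhdsGT hδ] with r hr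
  have hr0 : 0 < r := hr.1
  have h3 := hwb r hr
  rw [hw₀, sub_zero] at h3
  have e0 : r ^ (-(1 / 2 + ν)) * r ^ (1 / 2 + ν) = 1 := by
    rw [← Real.rpow_add hr0]; simp
  have e1 : r ^ (-(1 / 2 + ν)) * r ^ (1 / 2 + ν - 1) = r⁻¹ := by
    rw [← Real.rpow_add hr0, ← Real.rpow_neg_one]; congr 1; ring
  have e2 : dF r = ((r ^ (-(1 / 2 + ν)) : ℝ) : ℂ) * w r + (((1 / 2 + ν) * r⁻¹ : ℝ) : ℂ) * F r := by
    have e0' : ((r ^ (-(1 / 2 + ν)) : ℝ) : ℂ) * ((r ^ (1 / 2 + ν) : ℝ) : ℂ) = 1 := by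
      exact_mod_cast e0
    rw [← e1, hw]
    push_cast
    linear_combination -dF r * e0'
  have h4 : ‖dF r‖ ≤ r ^ (-(1 / 2 + ν)) * (C * r ^ (1 + ν)) + (1 / 2 + ν) * r⁻¹ * ‖F r‖ := by
    rw [e2]
    refine (norm_add_le _ _).trans ?_
    rw [norm_mul, norm_mul, Complex.norm_real, Complex.norm_real,
      Real.norm_of_nonneg (by positivity), Real.norm_of_nonneg (by positivity)]
    gcongr
  have e5 : r ^ (-(1 / 2 + ν)) * (C * r ^ (1 + ν)) = C * r * r ^ (-(1 / 2 : ℝ)) := by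
    have : r * r ^ (-(1 / 2 : ℝ)) = r ^ (-(1 / 2 + ν)) * r ^ (1 + ν) := by
      rw [← Real.rpow_add hr0]
      nth_rewrite 1 [← Real.rpow_one r]
      rw [← Real.rpow_add hr0]; congr 1; ring
    rw [mul_assoc C, this]; ring
  rw [norm_mul, RCLike.norm_conj]
  calc ‖dF r‖ * ‖F r‖ ≤ (r ^ (-(1 / 2 + ν)) * (C * r ^ (1 + ν)) + (1 / 2 + ν) * r⁻¹ * ‖F r‖) *
        ‖F r‖ := by gcongr
    _ = _ := by rw [e5]; ring

/-! ### Eigenvalues below the ground state energy and off the real axis -/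

lemma le_of_hasDerivAt_nonneg_off_finset (s : Finset ℝ) : ∀ {f : ℝ → ℝ} {a b : ℝ}, a ≤ b →
    ContinuousOn f (Icc a b) →
    (∀ x ∈ Ioo a b, x ∉ s → ∃ f', HasDerivAt f f' x ∧ 0 ≤ f') → f a ≤ f b := by
  induction s using Finset.induction_on with
  | empty =>
    intro f a b hab hc hd
    have h : MonotoneOn f (Icc a b) := by
      refine monotoneOn_of_deriv_nonneg (convex_Icc a b) hc ?_ ?_
      · rw [interior_Icc]
        intro x hx
        obtain ⟨f', h, -⟩ := hd x hx (by simp)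
        exact h.differentiableAt.differentiableWithinAt
      · rw [interior_Icc]
        intro x hx
        obtain ⟨f', h, h0⟩ := hd x hx (by simp)
        rwa [h.deriv]
    exact h (left_mem_Icc.2 hab) (right_mem_Icc.2 hab) hab
  | insert p s _ ih =>
    intro f a b hab hc hd
    by_cases hp : p ∈ Ioo a b
    · have h1 : f a ≤ f p := by
        refine ih hp.1.le (hc.mono (Icc_subset_Icc_right hp.2.le)) fun x hx hxs ↦ ?_
        refine hd x ⟨hx.1, hx.2.trans hp.2⟩ ?_
        simp [hx.2.ne, hxs]
      have h2 : f p ≤ f b := by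
        refine ih hp.2.le (hc.mono (Icc_subset_Icc_left hp.1.le)) fun x hx hxs ↦ ?_
        refine hd x ⟨hp.1.trans hx.1, hx.2⟩ ?_
        simp [hx.1.ne', hxs]
      exact h1.trans h2
    · refine ih hab hc fun x hx hxs ↦ hd x hx ?_
      simp only [Finset.mem_insert, not_or]
      exact ⟨fun h ↦ hp (h ▸ hx), hxs⟩

lemma le_of_hasDerivAt_nonneg_off_radii {d : ℝ} (hd : 0 < d) {f : ℝ → ℝ} {a b : ℝ} (hab : a ≤ b)
    (hc : ContinuousOn f (Icc a b))
    (h : ∀ x ∈ Ioo a b, (∀ n, x ≠ radius d n) → ∃ f', HasDerivAt f f' x ∧ 0 ≤ f') :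
    f a ≤ f b := by
  obtain ⟨m, hm⟩ := exists_nat_gt (b / d)
  refine le_of_hasDerivAt_nonneg_off_finset ((Finset.range m).image (radius d)) hab hc
    fun x hx hxs ↦ h x hx ?_
  rintro n rfl
  refine hxs (Finset.mem_image_of_mem _ (Finset.mem_range.2 ?_))
  rw [div_lt_iff₀ hd] at hm
  have h1 := hx.2
  rw [radius] at h1
  have : (n : ℝ) < m := by nlinarith
  exact_mod_cast this

lemma eventually_ne_radius {d : ℝ} (hd : 0 < d) {r : ℝ} (hn : ∀ n, r ≠ radius d n) :
    ∀ᶠ s in 𝓝 r, ∀ n, s ≠ radius d n := by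
  filter_upwards [(isClosed_radii hd).isOpen_compl.mem_nhds
    (fun ⟨n, h⟩ ↦ hn n h.symm : r ∈ (range (radius d))ᶜ)] with s hs n h
  exact hs ⟨n, h.symm⟩

lemma eventually_ne_radius_punctured {d : ℝ} (hd : 0 < d) (m : ℕ) :
    ∀ᶠ s in 𝓝[≠] (radius d m), ∀ n, s ≠ radius d n := by
  filter_upwards [self_mem_nhdsWithin, mem_nhdsWithin_of_mem_nhds
    (Metric.ball_mem_nhds (radius d m) hd)] with s hs hball n h
  subst h
  rw [Metric.mem_ball, Real.dist_eq, radius, radius, ← mul_sub, abs_mul, abs_of_pos hd] at hball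
  have h1 : |(n : ℝ) - m| < 1 := by
    have : |(n : ℝ) - m| = |(n : ℝ) + 1 / 2 - (m + 1 / 2)| := by congr 1; ring
    rw [this]
    exact lt_of_mul_lt_mul_left (by linarith) hd.le
  have h2 : |(n : ℤ) - m| < 1 := by exact_mod_cast h1
  rw [Int.abs_lt_one_iff] at h2
  have : n = m := by omega
  exact hs (by rw [this]; rfl)

/-- A function with removable discontinuities at the radii agrees off the radii with a continuous
one. -/
lemma exists_continuousOn_eq_off_radii {d : ℝ} (hd : 0 < d) {f : ℝ → ℂ}
    (hf : ∀ r > 0, (∀ n, r ≠ radius d n) → ContinuousAt f r)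
    (hj : ∀ n, ∃ v, Tendsto f (𝓝[≠] (radius d n)) (𝓝 v)) :
    ∃ f' : ℝ → ℂ, ContinuousOn f' (Ioi 0) ∧ ∀ r, (∀ n, r ≠ radius d n) → f' =ᶠ[𝓝 r] f := by
  classical
  refine ⟨fun r ↦ if ∀ n, r ≠ radius d n then f r else limUnder (𝓝[≠] r) f, ?_, ?_⟩
  · intro r hr
    refine ContinuousAt.continuousWithinAt ?_
    by_cases hn : ∀ n, r ≠ radius d n
    · refine (hf r hr hn).congr ?_
      filter_upwards [eventually_ne_radius hd hn] with s hs
      rw [if_pos hs]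
    · rw [continuousAt_iff_punctured_nhds, if_neg hn]
      push Not at hn
      obtain ⟨n, rfl⟩ := hn
      refine (tendsto_nhds_limUnder (hj n)).congr' ?_
      filter_upwards [eventually_ne_radius_punctured hd n] with s hs
      rw [if_pos hs]
  · intro r hr
    filter_upwards [eventually_ne_radius hd hr] with s hs
    rw [if_pos hs]

/-- The eigenvalue equation in the classical sense off the radii. -/
lemma IsRadialPair.hasDerivAt_deriv {d α β : ℝ} (hd : 0 < d) {l : ℤ} {F dF g : ℝ → ℂ} {z : ℂ}
    (h : IsRadialPair d α β l F dF g) (hg : g =ᵐ[halfLine] fun r ↦ z * F r) {r : ℝ} (hr : 0 < r)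
    (hn : ∀ n, r ≠ radius d n) :
    HasDerivAt dF (((centrifugal α l / r ^ 2 : ℝ) : ℂ) * F r - z * F r) r := by
  have hev : ∀ᶠ s in 𝓝 r, 0 < s ∧ ∀ n, s ≠ radius d n :=
    (lt_mem_nhds hr).and (eventually_ne_radius hd hn)
  obtain ⟨ε, hε, hball⟩ := Metric.eventually_nhds_iff_ball.1 hev
  rw [Real.ball_eq_Ioo] at hball
  set q : ℝ → ℂ := fun s ↦ ((centrifugal α l / s ^ 2 : ℝ) : ℂ) * F s - z * F s with hq
  have hqc : ContinuousOn q (Ioi 0) := by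
    refine ContinuousOn.sub (ContinuousOn.mul ?_ h.continuousOn)
      (continuousOn_const.mul h.continuousOn)
    refine Complex.continuous_ofReal.comp_continuousOn ?_
    exact continuousOn_const.div (by fun_prop) fun x hx ↦ pow_ne_zero 2 (ne_of_gt hx)
  set a := r - ε / 2 with ha
  have ha0 : 0 < a := (hball a ⟨by linarith, by linarith⟩).1
  have har : a < r := by linarith
  have hint : ∀ᶠ b in 𝓝 r, dF b = dF a + ∫ s in a..b, q s := by
    filter_upwards [Ioo_mem_nhds har (show r < r + ε by linarith)] with b hb
    have e := h.integral_eq a b ha0 hb.1.le fun n hn' ↦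
      (hball _ ⟨by linarith [hn'.1], by linarith [hn'.2, hb.2]⟩).2 n rfl
    have e2 : ∫ s in a..b, (((centrifugal α l / s ^ 2 : ℝ) : ℂ) * F s - g s)
        = ∫ s in a..b, q s := by
      rw [intervalIntegral.integral_of_le hb.1.le, intervalIntegral.integral_of_le hb.1.le]
      refine integral_congr_ae ?_
      have hle : volume.restrict (Ioc a b) ≤ halfLine :=
        Measure.restrict_mono (fun x hx ↦ ha0.trans hx.1) le_rfl
      filter_upwards [ae_mono hle hg] with s hs
      rw [hs]
    rw [← e2, ← e]; ring
  have hd1 : HasDerivAt (fun b ↦ ∫ s in a..b, q s) (q r) r := by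
    refine intervalIntegral.integral_hasDerivAt_right
      (ContinuousOn.intervalIntegrable (hqc.mono ?_))
      (hqc.stronglyMeasurableAtFilter isOpen_Ioi r hr) (hqc.continuousAt (Ioi_mem_nhds hr))
    rw [uIcc_of_le har.le]
    exact fun x hx ↦ ha0.trans_le hx.1
  exact (hd1.const_add (dF a)).congr_of_eventuallyEq hint

/-- The function `χ = φ'/φ + 1/(2 φ² r)`. For `φ = 1` it is the logarithmic derivative of `√r`, which
gives Hardy's inequality; in general `χ' + χ² = -E - (x - x²)/r²` with `x = 1/(2 φ²)`, and `χ` jumps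
by `β` at the radii. -/
noncomputable def riccati (φ dφ : ℝ → ℝ) (r : ℝ) : ℝ := dφ r / φ r + (2 * φ r ^ 2 * r)⁻¹

section
variable {d α β E : ℝ} {φ dφ : ℝ → ℝ}

lemma IsGroundState.hasDerivAt_riccati (h : IsGroundState d β E φ dφ) {r : ℝ} (hr : 0 < r)
    (hn : ∀ n, r ≠ radius d n) :
    HasDerivAt (riccati φ dφ) (-E - riccati φ dφ r ^ 2 -
      ((φ r ^ 2)⁻¹ / 2 - ((φ r ^ 2)⁻¹ / 2) ^ 2) / r ^ 2) r := by
  have hp := h.pos r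
  have h1 := (h.hasDerivAt_deriv r hr hn).div (h.hasDerivAt r hr hn) hp.ne'
  have h2 := ((((h.hasDerivAt r hr hn).pow 2).const_mul 2).mul (hasDerivAt_id r)).inv
    (by simp; exact ⟨hp.ne', hr.ne'⟩)
  refine (h1.add h2).congr_deriv ?_
  simp only [riccati, id, Pi.pow_apply, Pi.mul_apply]
  have hp' := hp.ne'
  have hr' := hr.ne'
  field_simp
  ring

lemma centrifugal_ge (hα : α ∈ Ioo (0 : ℝ) (1 / 2)) (l : ℤ) :
    -1 / 4 + α ^ 2 ≤ centrifugal α l := by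
  obtain ⟨h0, h1⟩ := hα
  rw [centrifugal]
  rcases lt_trichotomy l 0 with h | rfl | h
  · have : (l : ℝ) ≤ -1 := by exact_mod_cast Int.le_sub_one_of_lt h
    nlinarith
  · simp
  · have : (1 : ℝ) ≤ l := by exact_mod_cast h
    nlinarith

/-- What remains of the centrifugal potential after the Riccati function is subtracted is nonnegative:
with `x = y / 2` one has `x - x² = 1/4 - (x - 1/2)² ≥ 1/4 - α²`. -/
lemma le_effective_potential (hα : α ∈ Ioo (0 : ℝ) (1 / 2)) {y : ℝ} (hy : |y - 1| ≤ 2 * α)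
    (l : ℤ) (r : ℝ) : 0 ≤ centrifugal α l / r ^ 2 + (y / 2 - (y / 2) ^ 2) / r ^ 2 := by
  rw [← add_div]
  refine div_nonneg ?_ (sq_nonneg r)
  have h1 := centrifugal_ge hα l
  have h2 : (y - 1) ^ 2 ≤ (2 * α) ^ 2 := by
    rw [← sq_abs]
    gcongr
  nlinarith

/-- Off `[E, ∞)`, the energy `E - z` can be rotated into the right half-plane by a factor in the
right half-plane. -/
lemma exists_rotation {E : ℝ} {z : ℂ} (hz : z.im ≠ 0 ∨ z.re < E) :
    ∃ u : ℂ, 0 < u.re ∧ 0 < (u * (E - z)).re := by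
  by_cases h : z.im = 0
  · exact ⟨1, by simp, by simpa using hz.resolve_left (not_not_intro h)⟩
  · refine ⟨⟨1, (1 - (E - z.re)) / z.im⟩, by simp, ?_⟩
    simp only [mul_re, sub_re, ofReal_re, sub_im, ofReal_im]
    have : (1 - (E - z.re)) / z.im * (0 - z.im) = -(1 - (E - z.re)) := by field_simp; ring
    rw [this]
    norm_num

end

section
variable {d α β E : ℝ} {φ dφ : ℝ → ℝ} {l : ℤ} {F dF g : ℝ → ℂ} {z : ℂ}

/-- The quasi-derivative `F' - χ F` is continuous across the radii, because `F'` jumps by `β F` and `χ`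
by `β`. -/
lemma exists_quasiDerivative (hd : 0 < d) (h : IsRadialPair d α β l F dF g)
    (hg : g =ᵐ[halfLine] fun r ↦ z * F r) (hE : IsGroundState d β E φ dφ) :
    ∃ Φ : ℝ → ℂ, ContinuousOn Φ (Ioi 0) ∧
      ∀ r, (∀ n, r ≠ radius d n) → Φ =ᶠ[𝓝 r] fun s ↦ dF s - (riccati φ dφ s : ℂ) * F s := by
  refine exists_continuousOn_eq_off_radii hd (fun r hr hn ↦ ?_) fun n ↦ ?_
  · exact (h.hasDerivAt_deriv hd hg hr hn).continuousAt.sub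
      ((Complex.continuous_ofReal.continuousAt.comp
        (hE.hasDerivAt_riccati hr hn).continuousAt).mul (h.hasDerivAt r hr hn).continuousAt)
  · have hr : 0 < radius d n := by rw [radius]; positivity
    have hp := hE.pos (radius d n)
    obtain ⟨p, m, hp1, hm1, e1⟩ := h.jump n
    obtain ⟨p', m', hp2, hm2, e2⟩ := hE.jump n
    have hFc : ContinuousAt F (radius d n) := h.continuousOn.continuousAt (Ioi_mem_nhds hr)
    have hφc : ContinuousAt φ (radius d n) := hE.continuousOn.continuousAt (Ioi_mem_nhds hr)
    have hinv : ContinuousAt (fun r ↦ (2 * φ r ^ 2 * r)⁻¹) (radius d n) :=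
      ((continuousAt_const.mul (hφc.pow 2)).mul continuousAt_id).inv₀
        (mul_pos (mul_pos two_pos (pow_pos hp 2)) hr).ne'
    have hlim : ∀ {s : Set ℝ} {q : ℂ} {q' : ℝ}, Tendsto dF (𝓝[s] (radius d n)) (𝓝 q) →
        Tendsto dφ (𝓝[s] (radius d n)) (𝓝 q') →
        Tendsto (fun s ↦ dF s - (riccati φ dφ s : ℂ) * F s) (𝓝[s] (radius d n))
          (𝓝 (q - ((q' / φ (radius d n) + (2 * φ (radius d n) ^ 2 * radius d n)⁻¹ : ℝ) : ℂ) *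
            F (radius d n))) := by
      intro s q q' h1 h2
      have h3 := (h2.div (hφc.mono_left nhdsWithin_le_nhds) hp.ne').add
        (hinv.mono_left nhdsWithin_le_nhds)
      exact h1.sub (((Complex.continuous_ofReal.tendsto _).comp h3).mul
        (hFc.mono_left nhdsWithin_le_nhds))
    have hR := hlim hp1 hp2
    have hL := hlim hm1 hm2
    refine ⟨p - ((p' / φ (radius d n) + (2 * φ (radius d n) ^ 2 * radius d n)⁻¹ : ℝ) : ℂ) *
      F (radius d n), ?_⟩
    rw [← Iio_union_Ioi, nhdsWithin_union]
    refine Tendsto.sup ?_ hR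
    convert hL using 2
    have e3 : p' = m' + β * φ (radius d n) := by linarith
    have e4 : p = m + β * F (radius d n) := by linear_combination e1
    have hpC : (φ (radius d n) : ℂ) ≠ 0 := by exact_mod_cast hp.ne'
    have hrC : (radius d n : ℂ) ≠ 0 := by exact_mod_cast hr.ne'
    rw [e3, e4]
    push_cast
    field_simp
    ring

lemma integrableOn_sq (hF : MemLp F 2 halfLine) : IntegrableOn (fun r ↦ ‖F r‖ ^ 2) (Ioi 0) :=
  (memLp_two_iff_integrable_sq_norm hF.1).1 hF

/-- A monotone function with `M' ≥ a M² (2 - f)`, where `f ≥ 0` is integrable, is nonpositive: once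
`M > 0`, integration of `(-1/M)' ≥ a (2 - f)` bounds `a (2 T - ∫ f)` uniformly in the upper end `T` of
the interval. -/
lemma nonpos_of_growth {a : ℝ} (hd : 0 < d) (ha : 0 < a) {M f : ℝ → ℝ}
    (hM : ContinuousOn M (Ioi 0)) (hf : ContinuousOn f (Ioi 0)) (hf0 : ∀ r, 0 ≤ f r)
    (hint : IntegrableOn f (Ioi 0)) (hmono : ∀ r s, 0 < r → r ≤ s → M r ≤ M s)
    (hM' : ∀ r > 0, (∀ n, r ≠ radius d n) →
      ∃ M', HasDerivAt M M' r ∧ a * M r ^ 2 * (2 - f r) ≤ M') {r : ℝ} (hr : 0 < r) :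
    M r ≤ 0 := by
  by_contra hcon
  push Not at hcon
  set N := ∫ s in Ioi 0, f s with hN
  have key : ∀ T, r ≤ T → -(M r)⁻¹ ≤ -a * (2 * (T - r) - N) := by
    intro T hT
    have hpos : ∀ s, r ≤ s → 0 < M s := fun s hs ↦ hcon.trans_le (hmono r s hr hs)
    have hii : ∀ s, r ≤ s → IntervalIntegrable f volume r s := fun s hs ↦
      ContinuousOn.intervalIntegrable (hf.mono fun x hx ↦ by
        rw [uIcc_of_le hs] at hx; exact hr.trans_le hx.1)
    have hder : ∀ s, r ≤ s → HasDerivAt (fun t ↦ ∫ x in r..t, f x) (f s) s := fun s hs ↦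
      intervalIntegral.integral_hasDerivAt_right (hii s hs)
        (hf.stronglyMeasurableAtFilter isOpen_Ioi s (hr.trans_le hs))
        (hf.continuousAt (Ioi_mem_nhds (hr.trans_le hs)))
    have h := le_of_hasDerivAt_nonneg_off_radii hd hT
      (f := fun s ↦ -(M s)⁻¹ - a * (2 * s - ∫ x in r..s, f x)) ?_ ?_
    · have h1 : ∫ x in r..T, f x ≤ N := by
        rw [intervalIntegral.integral_of_le hT]
        exact setIntegral_mono_set hint (ae_of_all _ hf0)
          (ae_of_all _ fun x hx ↦ hr.trans hx.1)
      have h2 : 0 < (M T)⁻¹ := inv_pos.2 (hpos T hT)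
      simp only [intervalIntegral.integral_same] at h
      nlinarith
    · intro s hs
      have hs0 : 0 < s := hr.trans_le hs.1
      refine ContinuousAt.continuousWithinAt ?_
      exact ((hM.continuousAt (Ioi_mem_nhds hs0)).inv₀ (hpos s hs.1).ne').neg.sub
        (continuousAt_const.mul ((continuousAt_const.mul continuousAt_id).sub
          (hder s hs.1).continuousAt))
    · intro s hs hn
      have hs0 : 0 < s := hr.trans hs.1
      obtain ⟨M', h1, h2⟩ := hM' s hs0 hn
      have hMs := hpos s hs.1.le
      refine ⟨_, (h1.inv hMs.ne').neg.sub
        ((((hasDerivAt_id s).const_mul 2).sub (hder s hs.1.le)).const_mul a), ?_⟩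
      have h3 : a * (2 - f s) ≤ M' / M s ^ 2 := by
        rw [le_div_iff₀ (by positivity)]
        linarith
      rw [neg_div, neg_neg, mul_one]
      linarith
  -- A value of `T ≥ r` with `a (2 (T - r) - N) > 1 / M r`.
  have h1 := key (r + (N + ((M r)⁻¹ + 1) / a) / 2 + |N + ((M r)⁻¹ + 1) / a|) (by
    have := neg_abs_le (N + ((M r)⁻¹ + 1) / a)
    linarith [abs_nonneg (N + ((M r)⁻¹ + 1) / a)])
  have h2 : (0 : ℝ) ≤ |N + ((M r)⁻¹ + 1) / a| := abs_nonneg _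
  have h3 : a * (((M r)⁻¹ + 1) / a) = (M r)⁻¹ + 1 := by field_simp
  nlinarith

lemma inv_le_two (hα : α ∈ Ioo (0 : ℝ) (1 / 2)) {x : ℝ} (hx : |(x ^ 2)⁻¹ - 1| ≤ 2 * α) :
    (x ^ 2)⁻¹ ≤ 2 ∧ x⁻¹ ≤ 2 := by
  have h1 := (abs_le.1 hx).2
  have h2 : (x ^ 2)⁻¹ ≤ 2 := by linarith [hα.2]
  refine ⟨h2, ?_⟩
  rw [← inv_pow] at h2
  nlinarith [sq_nonneg (x⁻¹ - 1)]

lemma IsRadialPair.tendsto_origin (hd : 0 < d) (hα : α ∈ Ioo (0 : ℝ) (1 / 2))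
    (h : IsRadialPair d α β l F dF g) (hg : g =ᵐ[halfLine] fun r ↦ z * F r)
    (hF : MemLp F 2 halfLine) :
    Tendsto (fun r ↦ ‖F r‖ ^ 2 / r) (𝓝[>] 0) (𝓝 0) ∧
      Tendsto (fun r ↦ dF r * starRingEnd ℂ (F r)) (𝓝[>] 0) (𝓝 0) := by
  have hne : ∀ r ∈ Ioo 0 (d / 2), ∀ n, r ≠ radius d n := by
    rintro r hr n rfl
    have := hr.2
    rw [radius] at this
    have : 0 ≤ d * n := by positivity
    linarith
  have hν : 0 < |(l : ℝ) + α| := by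
    rw [abs_pos]
    intro h0
    rcases lt_or_ge l 0 with h | h
    · have : (l : ℝ) ≤ -1 := by exact_mod_cast Int.le_sub_one_of_lt h
      linarith [hα.1, hα.2]
    · have : (0 : ℝ) ≤ l := by exact_mod_cast h
      linarith [hα.1, hα.2]
  refine AharonovBohm.tendsto_origin (ν := |(l : ℝ) + α|) (z := z) hν (half_pos hd)
    (fun r hr ↦ h.hasDerivAt r hr.1 (hne r hr)) (fun r hr ↦ ?_) (integrableOn_sq hF) fun h1 ↦ ?_
  · have := h.hasDerivAt_deriv hd hg hr.1 (hne r hr)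
    rwa [sq_abs]
  · rw [abs_lt] at h1
    have hl : l = 0 ∨ l = -1 := by
      have h2 : (l : ℝ) < 1 := by linarith [hα.1]
      have h3 : (-2 : ℝ) < l := by linarith [hα.2]
      have h4 : l < 1 := by exact_mod_cast h2
      have h5 : -2 < l := by exact_mod_cast h3
      omega
    rcases hl with rfl | rfl
    · have := h.bc_zero rfl
      simpa [abs_of_pos hα.1] using this
    · have := h.bc_neg_one rfl
      have e : |((-1 : ℤ) : ℝ) + α| = 1 - α := by
        push_cast
        rw [abs_of_neg (by linarith [hα.2])]
        ring
      rwa [e]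

/-- The radial operators have no eigenvalues off `[E, ∞)`. For an eigenfunction `F` and
`Φ = F' - χ F`,
`(Φ F̄)' = |Φ|² + (c r⁻² + (x - x²) r⁻² + E - z) |F|²`,
and after multiplication by a suitable constant `u` the real part of the right-hand side is bounded
below by `Re u |Φ|² + κ |F|²` with `κ > 0`. The function `M = Re (u Φ F̄)` is therefore monotone; it
tends to `0` at the origin and is nonpositive at infinity, hence vanishes, and so does `F`. -/
lemma IsRadialPair.ae_eq_zero (hd : 0 < d) (hα : α ∈ Ioo (0 : ℝ) (1 / 2))
    (hE : IsGroundState d β E φ dφ) (hφ : ∀ r, |(φ r ^ 2)⁻¹ - 1| ≤ 2 * α)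
    (hz : z.im ≠ 0 ∨ z.re < E) (h : IsRadialPair d α β l F dF g)
    (hg : g =ᵐ[halfLine] fun r ↦ z * F r) (hF : MemLp F 2 halfLine) :
    F =ᵐ[halfLine] 0 := by
  obtain ⟨u, hu, huz⟩ := exists_rotation hz
  obtain ⟨Φ, hΦc, hΦ⟩ := exists_quasiDerivative hd h hg hE
  have hu0 : 0 < ‖u‖ := norm_pos_iff.2 fun h0 ↦ by simp [h0] at hu
  set κ := (u * (E - z)).re with hκ
  set M : ℝ → ℝ := fun r ↦ (u * (Φ r * starRingEnd ℂ (F r))).re with hM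
  have hMc : ContinuousOn M (Ioi 0) := by
    refine Complex.continuous_re.comp_continuousOn (continuousOn_const.mul (hΦc.mul ?_))
    exact Complex.continuous_conj.comp_continuousOn h.continuousOn
  have hder : ∀ r > 0, (∀ n, r ≠ radius d n) →
      ∃ M', HasDerivAt M M' r ∧ u.re * ‖Φ r‖ ^ 2 + κ * ‖F r‖ ^ 2 ≤ M' := by
    intro r hr hn
    have h1 := (h.hasDerivAt_deriv hd hg hr hn).sub
      ((hE.hasDerivAt_riccati hr hn).ofReal_comp.mul (h.hasDerivAt r hr hn))
    have h2 := h1.congr_of_eventuallyEq (hΦ r hn)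
    have h3 : HasDerivAt (fun s ↦ starRingEnd ℂ (F s)) (starRingEnd ℂ (dF r)) r :=
      (h.hasDerivAt r hr hn).star
    have hval := (hΦ r hn).eq_of_nhds
    set χ := riccati φ dφ r with hχ
    set s := centrifugal α l / r ^ 2 + ((φ r ^ 2)⁻¹ / 2 - ((φ r ^ 2)⁻¹ / 2) ^ 2) / r ^ 2 with hs
    have hs0 : 0 ≤ s := le_effective_potential hα (hφ r) l r
    have hdF : dF r = Φ r + χ * F r := by rw [hval]; ring
    refine ⟨_, Complex.reCLM.hasFDerivAt.comp_hasDerivAt r ((h2.mul h3).const_mul u), ?_⟩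
    have e : ∀ A B : ℂ, A = B → A.re = B.re := fun _ _ h ↦ by rw [h]
    have e2 : (u * ((((centrifugal α l / r ^ 2 : ℝ) : ℂ) * F r - z * F r -
        (((-E - χ ^ 2 - ((φ r ^ 2)⁻¹ / 2 - ((φ r ^ 2)⁻¹ / 2) ^ 2) / r ^ 2 : ℝ) : ℂ) * F r +
          (χ : ℂ) * dF r)) * starRingEnd ℂ (F r) + Φ r * starRingEnd ℂ (dF r))).re =
        u.re * ‖Φ r‖ ^ 2 + (κ + u.re * s) * ‖F r‖ ^ 2 := by
      have : u * ((((centrifugal α l / r ^ 2 : ℝ) : ℂ) * F r - z * F r -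
        (((-E - χ ^ 2 - ((φ r ^ 2)⁻¹ / 2 - ((φ r ^ 2)⁻¹ / 2) ^ 2) / r ^ 2 : ℝ) : ℂ) * F r +
          (χ : ℂ) * dF r)) * starRingEnd ℂ (F r) + Φ r * starRingEnd ℂ (dF r)) =
        u * (((‖Φ r‖ ^ 2 : ℝ) : ℂ)) + (u * (E - z) + u * (s : ℂ)) * ((‖F r‖ ^ 2 : ℝ) : ℂ) := by
        have n1 : ((‖Φ r‖ ^ 2 : ℝ) : ℂ) = Φ r * starRingEnd ℂ (Φ r) := by
          rw [Complex.mul_conj']; push_cast; rfl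
        have n2 : ((‖F r‖ ^ 2 : ℝ) : ℂ) = F r * starRingEnd ℂ (F r) := by
          rw [Complex.mul_conj']; push_cast; rfl
        rw [n1, n2, hdF, map_add, map_mul, Complex.conj_ofReal, hs]
        push_cast
        ring
      rw [this, Complex.add_re, Complex.re_mul_ofReal, Complex.re_mul_ofReal, Complex.add_re,
        Complex.re_mul_ofReal]
    refine le_trans ?_ (le_of_eq ?_ : u.re * ‖Φ r‖ ^ 2 + (κ + u.re * s) * ‖F r‖ ^ 2 ≤ _)
    · have : 0 ≤ u.re * s * ‖F r‖ ^ 2 := by positivity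
      linarith
    · rw [← e2]
      rfl
  have hmono : ∀ r s, 0 < r → r ≤ s → M r ≤ M s := by
    intro r s hr hrs
    refine le_of_hasDerivAt_nonneg_off_radii hd hrs
      (hMc.mono fun x hx ↦ hr.trans_le hx.1) fun x hx hn ↦ ?_
    obtain ⟨M', h1, h2⟩ := hder x (hr.trans hx.1) hn
    exact ⟨M', h1, le_trans (by positivity) h2⟩
  have hle : ∀ r > 0, M r ≤ 0 := by
    intro r hr
    refine nonpos_of_growth (f := fun r ↦ ‖F r‖ ^ 2) (a := u.re / ‖u‖ ^ 2) hd (by positivity) hMc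
      (h.continuousOn.norm.pow 2) (fun _ ↦ by positivity) (integrableOn_sq hF) hmono
      (fun s hs hn ↦ ?_) hr
    obtain ⟨M', h1, h2⟩ := hder s hs hn
    refine ⟨M', h1, le_trans ?_ h2⟩
    -- `|M| ≤ |u| |Φ| |F|`, and `y (2 - y) ≤ 1` for `y = |F|²`.
    have h3 : M s ^ 2 ≤ ‖u‖ ^ 2 * (‖Φ s‖ ^ 2 * ‖F s‖ ^ 2) := by
      rw [← mul_pow, ← mul_pow, ← sq_abs]
      refine pow_le_pow_left₀ (abs_nonneg _) ?_ 2
      refine (Complex.abs_re_le_norm _).trans_eq ?_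
      rw [norm_mul, norm_mul, RCLike.norm_conj]
    have h4 : 0 ≤ κ * ‖F s‖ ^ 2 := by positivity
    suffices h5 : u.re / ‖u‖ ^ 2 * M s ^ 2 * (2 - ‖F s‖ ^ 2) ≤ u.re * ‖Φ s‖ ^ 2 by linarith
    rcases le_total (2 - ‖F s‖ ^ 2) 0 with h6 | h6
    · have : u.re / ‖u‖ ^ 2 * M s ^ 2 * (2 - ‖F s‖ ^ 2) ≤ 0 :=
        mul_nonpos_of_nonneg_of_nonpos (by positivity) h6
      exact this.trans (by positivity)
    · calc u.re / ‖u‖ ^ 2 * M s ^ 2 * (2 - ‖F s‖ ^ 2)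
          ≤ u.re / ‖u‖ ^ 2 * (‖u‖ ^ 2 * (‖Φ s‖ ^ 2 * ‖F s‖ ^ 2)) * (2 - ‖F s‖ ^ 2) := by gcongr
        _ = u.re * ‖Φ s‖ ^ 2 * (‖F s‖ ^ 2 * (2 - ‖F s‖ ^ 2)) := by field_simp
        _ ≤ u.re * ‖Φ s‖ ^ 2 * 1 := by
            gcongr
            nlinarith [sq_nonneg (‖F s‖ ^ 2 - 1)]
        _ = _ := mul_one _
  have hne : ∀ r ∈ Ioo 0 (d / 2), ∀ n, r ≠ radius d n := by
    rintro r hr n rfl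
    have := hr.2
    rw [radius] at this
    have : 0 ≤ d * n := by positivity
    linarith
  have hzero : Tendsto M (𝓝[>] 0) (𝓝 0) := by
    obtain ⟨o1, o2⟩ := h.tendsto_origin hd hα hg hF
    obtain ⟨B, hB⟩ := hE.bounded_deriv
    have o3 : Tendsto (fun r ↦ ‖u‖ * (‖dF r * starRingEnd ℂ (F r)‖ +
        (2 * B * d + 1) * (‖F r‖ ^ 2 / r))) (𝓝[>] 0) (𝓝 0) := by
      simpa using (o2.norm.add (o1.const_mul (2 * B * d + 1))).const_mul ‖u‖
    refine squeeze_zero_norm' ?_ o3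
    filter_upwards [Ioo_mem_nhdsGT (half_pos hd)] with r hr
    have hr0 : 0 < r := hr.1
    have hval := (hΦ r (hne r hr)).eq_of_nhds
    rw [Real.norm_eq_abs]
    refine (Complex.abs_re_le_norm _).trans ?_
    rw [norm_mul, hval, sub_mul]
    refine mul_le_mul_of_nonneg_left ((norm_sub_le _ _).trans ?_) (norm_nonneg u)
    refine add_le_add le_rfl ?_
    rw [norm_mul, norm_mul, RCLike.norm_conj, Complex.norm_real, mul_assoc, ← sq,
      Real.norm_eq_abs]
    obtain ⟨i1, i2⟩ := inv_le_two hα (hφ r)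
    have hp := hE.pos r
    have hχ : |riccati φ dφ r| * r ≤ 2 * B * d + 1 := by
      have j1 : |dφ r / φ r| ≤ B * 2 := by
        rw [abs_div, abs_of_pos hp, div_eq_mul_inv]
        have := hB r
        have : 0 ≤ B := (abs_nonneg _).trans this
        gcongr
      have j2 : |(2 * φ r ^ 2 * r)⁻¹| * r ≤ 1 := by
        rw [abs_of_pos (by positivity)]
        have : (2 * φ r ^ 2 * r)⁻¹ * r = (φ r ^ 2)⁻¹ / 2 := by field_simp
        rw [this]
        linarith
      have j3 : |riccati φ dφ r| ≤ |dφ r / φ r| + |(2 * φ r ^ 2 * r)⁻¹| := abs_add_le _ _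
      have j4 : 0 ≤ B := (abs_nonneg _).trans (hB r)
      have j5 : r ≤ d := by linarith [hr.2]
      calc |riccati φ dφ r| * r ≤ (|dφ r / φ r| + |(2 * φ r ^ 2 * r)⁻¹|) * r := by gcongr
        _ = |dφ r / φ r| * r + |(2 * φ r ^ 2 * r)⁻¹| * r := by ring
        _ ≤ B * 2 * d + 1 := by gcongr
        _ = _ := by ring
    calc |riccati φ dφ r| * ‖F r‖ ^ 2 = |riccati φ dφ r| * r * (‖F r‖ ^ 2 / r) := by
          field_simp
      _ ≤ _ := by gcongr
  have hge : ∀ r > 0, 0 ≤ M r := by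
    intro r hr
    refine ge_of_tendsto' (x := 𝓝[>] (0 : ℝ)) (f := fun _ ↦ M r) tendsto_const_nhds fun _ ↦ ?_
    refine le_of_tendsto hzero ?_
    filter_upwards [Ioo_mem_nhdsGT hr] with s hs using hmono s r hs.1 hs.2.le
  have hM0 : ∀ r > 0, M r = 0 := fun r hr ↦ le_antisymm (hle r hr) (hge r hr)
  have hrad : ∀ᵐ x : ℝ, x ∉ range (radius d) := (countable_range _).ae_notMem _
  filter_upwards [ae_restrict_of_ae hrad, ae_restrict_mem measurableSet_Ioi] with r hn hr
  obtain ⟨M', h1, h2⟩ := hder r hr fun n e ↦ hn ⟨n, e.symm⟩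
  have h3 : M' = 0 := by
    refine (h1.congr_of_eventuallyEq ?_).unique (hasDerivAt_const r (0 : ℝ))
    filter_upwards [Ioi_mem_nhds hr] with s hs using (hM0 s hs).symm
  rw [h3] at h2
  have h4 : 0 ≤ u.re * ‖Φ r‖ ^ 2 := by positivity
  have h5 : ‖F r‖ ^ 2 ≤ 0 := by
    by_contra hc
    push Not at hc
    have := mul_pos huz hc
    linarith
  have h6 : ‖F r‖ = 0 := by
    have := le_antisymm h5 (sq_nonneg _)
    simpa using this
  simpa using h6

end

/-! ### Weyl sequences in high partial waves -/

/-- The function `(r, θ) ↦ (2π r)^{-1/2} u(r) e^{ilθ}` in the plane. -/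
noncomputable def partialWaveLift (l : ℤ) (u : ℝ → ℂ) (z : ℂ) : ℂ :=
  ((√(2 * Real.pi) * √‖z‖)⁻¹ : ℝ) * u ‖z‖ * exp (l * arg z * I)

lemma measurable_partialWaveLift (l : ℤ) {u : ℝ → ℂ} (hu : Measurable u) :
    Measurable (partialWaveLift l u) := by
  unfold partialWaveLift
  have h1 : Measurable fun z : ℂ ↦ u ‖z‖ := hu.comp measurable_norm
  have h2 : Measurable fun z : ℂ ↦ (((√(2 * Real.pi) * √‖z‖)⁻¹ : ℝ) : ℂ) :=
    Complex.measurable_ofReal.comp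
      ((measurable_const.mul (Real.continuous_sqrt.measurable.comp measurable_norm)).inv)
  have h3 : Measurable fun z : ℂ ↦ exp (l * arg z * I) := by
    have := Complex.measurable_ofReal.comp Complex.measurable_arg
    exact Complex.measurable_exp.comp ((this.const_mul _).mul_const _)
  exact (h2.mul h1).mul h3

lemma partialWaveLift_polar (l : ℤ) (u : ℝ → ℂ) {r θ : ℝ} (hr : 0 < r)
    (hθ : θ ∈ Ioc (-Real.pi) Real.pi) :
    partialWaveLift l u (r * exp (θ * I)) =
      ((√(2 * Real.pi) * √r)⁻¹ : ℝ) * u r * exp (l * θ * I) := by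
  have h1 : ‖(r : ℂ) * exp (θ * I)‖ = r := by
    rw [norm_mul, Complex.norm_exp_ofReal_mul_I, mul_one, Complex.norm_real,
      Real.norm_of_nonneg hr.le]
  have h2 : arg ((r : ℂ) * exp (θ * I)) = θ := by
    rw [exp_mul_I, arg_mul_cos_add_sin_mul_I hr hθ]
  rw [partialWaveLift, h1, h2]

lemma lintegral_partialWaveLift (l : ℤ) {u : ℝ → ℂ} (hu : Measurable u) :
    ∫⁻ z, ‖partialWaveLift l u z‖ₑ ^ 2 = ∫⁻ r in Ioi (0 : ℝ), ‖u r‖ₑ ^ 2 := by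
  rw [lintegral_polar ((measurable_partialWaveLift l hu).enorm.pow_const 2)]
  refine setLIntegral_congr_fun measurableSet_Ioi fun r hr ↦ ?_
  have hr0 : 0 < r := hr
  have h1 : ∀ θ ∈ Ioc (-Real.pi) Real.pi, ENNReal.ofReal r *
      ‖partialWaveLift l u (r * exp (θ * I))‖ₑ ^ 2 =
        ENNReal.ofReal (2 * Real.pi)⁻¹ * ‖u r‖ₑ ^ 2 := by
    intro θ hθ
    have h3 : (l : ℂ) * θ * I = ((l * θ : ℝ) : ℂ) * I := by push_cast; ring
    have h4 : ‖exp (l * θ * I)‖ₑ = 1 := by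
      rw [← ofReal_norm, h3, Complex.norm_exp_ofReal_mul_I, ENNReal.ofReal_one]
    rw [partialWaveLift_polar l u hr0 hθ, enorm_mul, enorm_mul, h4, mul_one, mul_pow, ← mul_assoc]
    congr 1
    rw [← ofReal_norm, Complex.norm_real, Real.norm_of_nonneg (by positivity),
      ← ENNReal.ofReal_pow (by positivity), ← ENNReal.ofReal_mul hr0.le]
    congr 1
    rw [inv_pow, mul_pow, Real.sq_sqrt (by positivity), Real.sq_sqrt hr0.le]
    field_simp
  rw [setLIntegral_congr_fun measurableSet_Ioc h1, setLIntegral_const, Real.volume_Ioc,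
    mul_right_comm, ← ENNReal.ofReal_mul (by positivity)]
  have : (2 * Real.pi)⁻¹ * (Real.pi - -Real.pi) = 1 := by
    have := Real.pi_pos
    field_simp
    ring
  rw [this, ENNReal.ofReal_one, one_mul]

lemma integral_exp_int_mul {m : ℤ} (hm : m ≠ 0) :
    ∫ θ in (-Real.pi)..Real.pi, exp (m * θ * I) = 0 := by
  have hc : (m : ℂ) * I ≠ 0 := mul_ne_zero (by exact_mod_cast hm) I_ne_zero
  have h1 : ∀ θ : ℝ, exp (m * θ * I) = exp (m * I * θ) := fun θ ↦ by congr 1; ring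
  simp_rw [h1]
  rw [integral_exp_mul_complex hc]
  have h2 : exp (m * I * (Real.pi : ℝ)) = exp (m * I * ((-Real.pi : ℝ) : ℂ)) := by
    rw [Complex.exp_eq_exp_iff_exists_int]
    exact ⟨m, by push_cast; ring⟩
  rw [h2, sub_self, zero_div]

lemma partialWave_partialWaveLift (l k : ℤ) (u : ℝ → ℂ) {r : ℝ} (hr : 0 < r) :
    partialWave k (partialWaveLift l u) r = if k = l then u r else 0 := by
  have hpi : -Real.pi ≤ Real.pi := by linarith [Real.pi_pos]
  have h1 : ∫ θ in (-Real.pi)..Real.pi,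
      partialWaveLift l u (r * exp (θ * I)) * exp (-(k * θ * I)) =
      ∫ θ in (-Real.pi)..Real.pi,
        (((√(2 * Real.pi) * √r)⁻¹ : ℝ) * u r) * exp (((l - k : ℤ) : ℂ) * θ * I) := by
    rw [intervalIntegral.integral_of_le hpi, intervalIntegral.integral_of_le hpi]
    refine setIntegral_congr_fun measurableSet_Ioc fun θ hθ ↦ ?_
    rw [partialWaveLift_polar l u hr hθ, mul_assoc, ← Complex.exp_add]
    congr 2
    push_cast
    ring
  rw [partialWave, h1, intervalIntegral.integral_const_mul]
  split_ifs with h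
  · subst h
    simp only [sub_self, Int.cast_zero, zero_mul, Complex.exp_zero,
      intervalIntegral.integral_const, Complex.real_smul]
    have h2 : √r / √(2 * Real.pi) * (√(2 * Real.pi) * √r)⁻¹ * (Real.pi - -Real.pi) = 1 := by
      have h3 : 0 < √r := Real.sqrt_pos.2 hr
      have h4 : 0 < √(2 * Real.pi) := Real.sqrt_pos.2 (by positivity)
      have h5 : √(2 * Real.pi) * √(2 * Real.pi) = 2 * Real.pi :=
        Real.mul_self_sqrt (by positivity)
      field_simp
      rw [sq, h5]
      ring
    have h3 : ((√r / √(2 * Real.pi) : ℝ) : ℂ) * (((√(2 * Real.pi) * √r)⁻¹ : ℝ) : ℂ) *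
        ((Real.pi - -Real.pi : ℝ) : ℂ) = 1 := by exact_mod_cast h2
    linear_combination (u r) * h3
  · rw [integral_exp_int_mul (sub_ne_zero.2 (Ne.symm h))]
    simp

lemma memLp_partialWaveLift (l : ℤ) {u : ℝ → ℂ} (hu : Measurable u) (hu2 : MemLp u 2 halfLine) :
    MemLp (partialWaveLift l u) 2 (volume : Measure ℂ) := by
  refine ⟨(measurable_partialWaveLift l hu).aestronglyMeasurable, ?_⟩
  rw [eLpNorm_lt_top_iff_lintegral_rpow_enorm_lt_top (by norm_num) (by norm_num)]
  have h := hu2.2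
  rw [eLpNorm_lt_top_iff_lintegral_rpow_enorm_lt_top (by norm_num) (by norm_num)] at h
  simp only [ENNReal.toReal_ofNat, ENNReal.rpow_ofNat] at h ⊢
  rwa [lintegral_partialWaveLift l hu]

lemma mem_hamiltonian_graph_of_radialGraph {d α β : ℝ} (hd : 0 < d) {l : ℤ} {u v : ℝ → ℂ}
    (hu : Measurable u) (hv : Measurable v) (h : RadialGraph d α β l u v) :
    ((memLp_partialWaveLift l hu h.1).toLp, (memLp_partialWaveLift l hv h.2.1).toLp) ∈
      (hamiltonian d α β).graph := by
  rw [hamiltonian_graph hd]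
  intro k
  have key : ∀ {w : ℝ → ℂ} (hw : MemLp (partialWaveLift l w) 2 (volume : Measure ℂ)),
      partialWave k hw.toLp =ᵐ[halfLine] fun r ↦ if k = l then w r else 0 := by
    intro w hw
    refine (partialWave_congr hw.coeFn_toLp k).trans ?_
    filter_upwards [ae_restrict_mem measurableSet_Ioi] with r hr
    exact partialWave_partialWaveLift l k w hr
  by_cases hk : k = l
  · subst hk
    refine h.congr ((key (memLp_partialWaveLift k hu h.1)).trans ?_).symm
      ((key (memLp_partialWaveLift k hv h.2.1)).trans ?_).symm <;>
    · filter_upwards with r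
      simp
  · refine (RadialGraph.zero d α β k).congr
      ((key (memLp_partialWaveLift l hu h.1)).trans ?_).symm
      ((key (memLp_partialWaveLift l hv h.2.1)).trans ?_).symm <;>
    · filter_upwards with r
      simp [hk]

lemma enorm_toLp_sq {f : ℂ → ℂ} (hf : MemLp f 2 (volume : Measure ℂ)) :
    ‖hf.toLp‖ₑ ^ 2 = ∫⁻ z, ‖f z‖ₑ ^ 2 := by
  rw [Lp.enorm_toLp, eLpNorm_eq_lintegral_rpow_enorm_toReal (by norm_num) (by norm_num)]
  simp only [ENNReal.toReal_ofNat, ENNReal.rpow_ofNat]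
  rw [← ENNReal.rpow_natCast, ← ENNReal.rpow_mul]
  norm_num

/-- At a regular value the radial operators are bounded below uniformly. -/
lemma exists_bound_of_isRegularValue {d α β : ℝ} (hd : 0 < d) {z : ℂ}
    (hz : (hamiltonian d α β).IsRegularValue z) :
    ∃ K : NNReal, ∀ (l : ℤ) (u v : ℝ → ℂ), Measurable u → Measurable v →
      RadialGraph d α β l u v →
        ∫⁻ r in Ioi (0 : ℝ), ‖u r‖ₑ ^ 2 ≤ K ^ 2 * ∫⁻ r in Ioi (0 : ℝ), ‖v r - z * u r‖ₑ ^ 2 := by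
  obtain ⟨R, hR, -⟩ := hz
  refine ⟨‖R‖₊, fun l u v hu hv h ↦ ?_⟩
  have hg := mem_hamiltonian_graph_of_radialGraph hd hu hv h
  rw [LinearPMap.mem_graph_iff] at hg
  obtain ⟨x, hx, hTx⟩ := hg
  simp only at hx hTx
  have h1 := hR x
  have h3 : MemLp (fun r ↦ v r - z * u r) 2 halfLine := h.2.1.sub (h.1.const_mul z)
  have hm : Measurable fun r ↦ v r - z * u r := hv.sub (hu.const_mul z)
  have h2 : hamiltonian d α β x - z • (x : PlaneL2) =
      (memLp_partialWaveLift l hm h3).toLp := by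
    rw [hTx, hx, ← MemLp.toLp_const_smul, ← MemLp.toLp_sub]
    congr 1
    funext w
    simp only [partialWaveLift, Pi.sub_apply, Pi.smul_apply, smul_eq_mul]
    ring
  rw [h2] at h1
  rw [← lintegral_partialWaveLift l hu, ← lintegral_partialWaveLift l hm,
    ← enorm_toLp_sq (memLp_partialWaveLift l hu h.1), ← enorm_toLp_sq (memLp_partialWaveLift l hm h3),
    ← mul_pow, ← hx, ← h1]
  gcongr
  exact R.le_opENorm _

/-- A twice differentiable cutoff function, equal to `1` on `[-1, 1]` and supported in `[-2, 2]`. -/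
lemma exists_cutoff : ∃ (b b' b'' : ℝ → ℝ) (C : ℝ), 0 < C ∧ (∀ x, HasDerivAt b (b' x) x) ∧
    (∀ x, HasDerivAt b' (b'' x) x) ∧ Continuous b'' ∧ (∀ x, |b x| ≤ C) ∧ (∀ x, |b' x| ≤ C) ∧
    (∀ x, |b'' x| ≤ C) ∧ (∀ x ∈ Icc (-1 : ℝ) 1, b x = 1) ∧
    ∀ x ∉ Icc (-2 : ℝ) 2, b x = 0 ∧ b' x = 0 ∧ b'' x = 0 := by
  let f : ContDiffBump (0 : ℝ) := ⟨1, 2, by norm_num, by norm_num⟩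
  have hf : ContDiff ℝ 2 f := f.contDiff
  have hf1 : ContDiff ℝ 1 (deriv f) := hf.deriv'
  have hf2 : ContDiff ℝ 0 (deriv (deriv f)) := hf1.deriv'
  have ht : tsupport f = Icc (-2 : ℝ) 2 := by
    rw [f.tsupport_eq, Real.closedBall_eq_Icc]
    norm_num [f]
  have ht1 : tsupport (deriv f) ⊆ Icc (-2 : ℝ) 2 := ht ▸ tsupport_deriv_subset
  have ht2 : tsupport (deriv (deriv f)) ⊆ Icc (-2 : ℝ) 2 := tsupport_deriv_subset.trans ht1
  have hbd : ∀ g : ℝ → ℝ, Continuous g → (∀ x ∉ Icc (-2 : ℝ) 2, g x = 0) →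
      ∃ C, ∀ x, |g x| ≤ C := by
    intro g hg h0
    obtain ⟨C, hC⟩ := isCompact_Icc.exists_bound_of_continuousOn
      (hg.continuousOn (s := Icc (-2 : ℝ) 2))
    refine ⟨max C 0, fun x ↦ ?_⟩
    by_cases hx : x ∈ Icc (-2 : ℝ) 2
    · exact (hC x hx).trans (le_max_left _ _)
    · rw [h0 x hx, abs_zero]
      exact le_max_right _ _
  have z0 : ∀ x ∉ Icc (-2 : ℝ) 2, f x = 0 := fun x hx ↦
    image_eq_zero_of_notMem_tsupport (by rwa [ht])
  have z1 : ∀ x ∉ Icc (-2 : ℝ) 2, deriv f x = 0 := fun x hx ↦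
    image_eq_zero_of_notMem_tsupport fun h ↦ hx (ht1 h)
  have z2 : ∀ x ∉ Icc (-2 : ℝ) 2, deriv (deriv f) x = 0 := fun x hx ↦
    image_eq_zero_of_notMem_tsupport fun h ↦ hx (ht2 h)
  obtain ⟨C0, h0⟩ := hbd f hf.continuous z0
  obtain ⟨C1, h1⟩ := hbd _ hf1.continuous z1
  obtain ⟨C2, h2⟩ := hbd _ hf2.continuous z2
  have p0 := (abs_nonneg _).trans (h0 0)
  have p1 := (abs_nonneg _).trans (h1 0)
  have p2 := (abs_nonneg _).trans (h2 0)
  refine ⟨f, deriv f, deriv (deriv f), C0 + C1 + C2 + 1, by linarith,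
    fun x ↦ (hf.differentiable (by norm_num) x).hasDerivAt,
    fun x ↦ (hf1.differentiable (by norm_num) x).hasDerivAt, hf2.continuous,
    fun x ↦ by linarith [h0 x], fun x ↦ by linarith [h1 x], fun x ↦ by linarith [h2 x],
    fun x hx ↦ f.one_of_mem_closedBall ?_, fun x hx ↦ ⟨z0 x hx, z1 x hx, z2 x hx⟩⟩
  rw [Real.closedBall_eq_Icc]
  simpa [f] using hx

lemma memLp_halfLine_of_bounded {f : ℝ → ℝ} (hf : Measurable f) {a b C : ℝ}
    (h0 : ∀ x ∉ Icc a b, f x = 0) (hC : ∀ x ∈ Icc a b, |f x| ≤ C) :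
    MemLp (fun r ↦ (f r : ℂ)) 2 halfLine := by
  have h1 : MemLp (fun r ↦ (f r : ℂ)) 2 (volume.restrict (Icc a b)) := by
    refine MemLp.of_bound (Complex.measurable_ofReal.comp hf).aestronglyMeasurable C ?_
    refine (ae_restrict_iff' measurableSet_Icc).2 (ae_of_all _ fun x hx ↦ ?_)
    rw [Complex.norm_real]
    exact hC x hx
  have h2 : MemLp ((Icc a b).indicator fun r ↦ (f r : ℂ)) 2 volume :=
    (memLp_indicator_iff_restrict measurableSet_Icc).2 h1
  have h3 : (Icc a b).indicator (fun r ↦ (f r : ℂ)) = fun r ↦ (f r : ℂ) := by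
    rw [indicator_eq_self]
    intro x hx
    by_contra hn
    exact hx (by simp [h0 x hn])
  rw [h3] at h2
  exact h2.mono_measure Measure.restrict_le_self

/-- The product of a ground state with a compactly supported `C²` function is in the domain of every
radial operator: the matching conditions at the radii are inherited from the ground state. -/
lemma radialGraph_mul_groundState {d α β E B₀ : ℝ} {l : ℤ} {φ dφ χ χ' χ'' : ℝ → ℝ}
    (hd : 0 < d) (hE : IsGroundState d β E φ dφ) (hφ : ∀ r, φ r ≤ B₀) {a b C : ℝ} (ha : 0 < a)
    (h1 : ∀ x, HasDerivAt χ (χ' x) x) (h2 : ∀ x, HasDerivAt χ' (χ'' x) x) (h3 : Continuous χ'')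
    (hC : ∀ x, |χ x| ≤ C ∧ |χ' x| ≤ C ∧ |χ'' x| ≤ C)
    (h0 : ∀ x ∉ Icc a b, χ x = 0 ∧ χ' x = 0 ∧ χ'' x = 0) :
    RadialGraph d α β l (fun r ↦ ((χ r * φ r : ℝ) : ℂ))
      (fun r ↦ ((centrifugal α l / r ^ 2 * (χ r * φ r) -
        (χ'' r * φ r + 2 * χ' r * dφ r - E * (χ r * φ r)) : ℝ) : ℂ)) := by
  obtain ⟨B, hB⟩ := hE.bounded_deriv
  have hB0 : 0 ≤ B₀ := (hE.pos 0).le.trans (hφ 0)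
  have hC0 : 0 ≤ C := (abs_nonneg _).trans (hC 0).1
  have hB' : 0 ≤ B := (abs_nonneg _).trans (hB 0)
  have c0 : Continuous χ := continuous_iff_continuousAt.2 fun x ↦ (h1 x).continuousAt
  have c1 : Continuous χ' := continuous_iff_continuousAt.2 fun x ↦ (h2 x).continuousAt
  have hφm := hE.measurable
  have hdφm := hE.measurable_deriv
  have hφa : ∀ r, |φ r| ≤ B₀ := fun r ↦ by rw [abs_of_pos (hE.pos r)]; exact hφ r
  have b0 : ∀ r, |χ r * φ r| ≤ C * B₀ := fun r ↦ by
    rw [abs_mul]; exact mul_le_mul (hC r).1 (hφa r) (abs_nonneg _) hC0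
  refine ⟨memLp_halfLine_of_bounded (c0.measurable.mul hφm) (a := a) (b := b) (C := C * B₀)
      (fun x hx ↦ by simp [(h0 x hx).1]) (fun x _ ↦ b0 x),
    memLp_halfLine_of_bounded (a := a) (b := b)
      (C := |centrifugal α l| / a ^ 2 * (C * B₀) + (C * B₀ + 2 * C * B + |E| * (C * B₀)))
      ?_ (fun x hx ↦ by simp [(h0 x hx).1, (h0 x hx).2.1, (h0 x hx).2.2]) (fun x hx ↦ ?_),
    fun r ↦ ((χ r * φ r : ℝ) : ℂ), fun r ↦ ((χ' r * φ r + χ r * dφ r : ℝ) : ℂ),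
    EventuallyEq.rfl, ?_⟩
  · have := c0.measurable
    have := c1.measurable
    have := h3.measurable
    fun_prop
  · refine (abs_sub _ _).trans (add_le_add ?_ ((abs_sub _ _).trans
      (add_le_add ((abs_add_le _ _).trans (add_le_add ?_ ?_)) ?_)))
    · rw [abs_mul, abs_div, abs_of_nonneg (sq_nonneg x)]
      refine mul_le_mul ?_ (b0 x) (abs_nonneg _) (by positivity)
      have := hx.1
      gcongr
    · rw [abs_mul]; exact mul_le_mul (hC x).2.2 (hφa x) (abs_nonneg _) hC0
    · rw [abs_mul, abs_mul, abs_of_pos (two_pos : (0 : ℝ) < 2)]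
      exact mul_le_mul (mul_le_mul_of_nonneg_left (hC x).2.1 two_pos.le) (hB x) (abs_nonneg _)
        (by positivity)
    · rw [abs_mul]; exact mul_le_mul_of_nonneg_left (b0 x) (abs_nonneg _)
  have hd1 : ∀ r > 0, (∀ n, r ≠ radius d n) →
      HasDerivAt (fun r ↦ χ r * φ r) (χ' r * φ r + χ r * dφ r) r := fun r hr hn ↦
    (h1 r).mul (hE.hasDerivAt r hr hn)
  have hd2 : ∀ r > 0, (∀ n, r ≠ radius d n) →
      HasDerivAt (fun r ↦ χ' r * φ r + χ r * dφ r)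
        (χ'' r * φ r + 2 * χ' r * dφ r - E * (χ r * φ r)) r := fun r hr hn ↦ by
    refine (((h2 r).mul (hE.hasDerivAt r hr hn)).add
      ((h1 r).mul (hE.hasDerivAt_deriv r hr hn))).congr_deriv ?_
    ring
  have hzero : ∀ {p : ℝ → ℂ}, Tendsto (fun r ↦ p r * ((χ r * φ r : ℝ) : ℂ)) (𝓝[>] 0) (𝓝 0) := by
    intro p
    refine tendsto_const_nhds.congr' ?_
    filter_upwards [Ioo_mem_nhdsGT ha] with r hr
    simp [(h0 r fun h ↦ hr.2.not_ge h.1).1]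
  refine ⟨?_, fun r hr hn ↦ (hd1 r hr hn).ofReal_comp, ?_, ?_, fun _ ↦ hzero, fun _ ↦ hzero⟩
  · exact Complex.continuous_ofReal.comp_continuousOn (c0.continuousOn.mul hE.continuousOn)
  · intro p q hp hpq hn
    have hsub : ∀ x ∈ Icc p q, 0 < x ∧ ∀ n, x ≠ radius d n := fun x hx ↦
      ⟨hp.trans_le hx.1, fun n h ↦ hn n (h ▸ hx)⟩
    have hcont : ContinuousOn (fun r ↦ χ'' r * φ r + 2 * χ' r * dφ r - E * (χ r * φ r))
        (Icc p q) := by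
      have e1 : ContinuousOn φ (Icc p q) := hE.continuousOn.mono fun x hx ↦ (hsub x hx).1
      have e2 : ContinuousOn dφ (Icc p q) := fun x hx ↦
        (hE.hasDerivAt_deriv x (hsub x hx).1 (hsub x hx).2).continuousAt.continuousWithinAt
      exact ((h3.continuousOn.mul e1).add ((continuousOn_const.mul c1.continuousOn).mul e2)).sub
        (continuousOn_const.mul (c0.continuousOn.mul e1))
    have e := intervalIntegral.integral_eq_sub_of_hasDerivAt (a := p) (b := q)
      (fun x hx ↦ hd2 x (hsub x (by rwa [uIcc_of_le hpq] at hx)).1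
        (hsub x (by rwa [uIcc_of_le hpq] at hx)).2)
      (ContinuousOn.intervalIntegrable (by rwa [uIcc_of_le hpq]))
    rw [← Complex.ofReal_sub, ← e, ← intervalIntegral.integral_ofReal]
    congr 1
    funext s
    push_cast
    ring
  · intro n
    obtain ⟨p, m, hp, hm, e⟩ := hE.jump n
    have hr : 0 < radius d n := by rw [radius]; positivity
    have hφc : ContinuousAt φ (radius d n) := hE.continuousOn.continuousAt (Ioi_mem_nhds hr)
    have hlim : ∀ {s : Set ℝ} {q : ℝ}, Tendsto dφ (𝓝[s] (radius d n)) (𝓝 q) →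
        Tendsto (fun r ↦ ((χ' r * φ r + χ r * dφ r : ℝ) : ℂ)) (𝓝[s] (radius d n))
          (𝓝 ((χ' (radius d n) * φ (radius d n) + χ (radius d n) * q : ℝ) : ℂ)) := by
      intro s q h
      exact (Complex.continuous_ofReal.tendsto _).comp
        (((c1.continuousAt.mul hφc).mono_left nhdsWithin_le_nhds).add
          ((c0.continuousAt.mono_left nhdsWithin_le_nhds).mul h))
    refine ⟨_, _, hlim hp, hlim hm, ?_⟩
    have e' : (p : ℂ) - m = β * φ (radius d n) := by exact_mod_cast e
    push_cast
    linear_combination (χ (radius d n) : ℂ) * e'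

/-- With `l ≈ R √μ` and `R` large, the centrifugal potential is nearly the constant `μ` on a fixed
window around `R`. -/
lemma exists_angular_momentum {μ α L η : ℝ} (hμ : 0 < μ) (hα : α ∈ Ioo (0 : ℝ) (1 / 2))
    (hL : 0 < L) (hη : 0 < η) :
    ∃ (l : ℤ) (R : ℝ), 2 * L < R ∧
      ∀ r ∈ Icc (R - 2 * L) (R + 2 * L), |centrifugal α l / r ^ 2 - μ| ≤ η := by
  obtain ⟨s, hs, rfl⟩ : ∃ s > 0, s ^ 2 = μ := ⟨√μ, Real.sqrt_pos.2 hμ, Real.sq_sqrt hμ.le⟩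
  set Q := 4 * (12 * s ^ 2 * L + 2 * s + 1) / η with hQ
  have hQ0 : 0 < Q := by positivity
  obtain ⟨N, hN⟩ := exists_nat_gt (s * (Q + 4 * L + 1))
  obtain ⟨R, hR⟩ : ∃ R : ℝ, s * R = N := ⟨N / s, by field_simp⟩
  have hRb : Q + 4 * L + 1 < R := lt_of_mul_lt_mul_left (hR ▸ hN) hs.le
  refine ⟨N, R, by linarith, fun r hr ↦ ?_⟩
  have hr1 : R / 2 ≤ r := by linarith [hr.1]
  have hr0 : 0 < r := by linarith
  have hR0 : 0 < R := by linarith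
  have e : centrifugal α N / r ^ 2 - s ^ 2 =
      (s ^ 2 * (R - r) * (R + r) + 2 * s * R * α + (α ^ 2 - 1 / 4)) / r ^ 2 := by
    rw [centrifugal, Int.cast_natCast, ← hR]
    field_simp
    ring
  rw [e, abs_div, abs_of_pos (pow_pos hr0 2), div_le_iff₀ (by positivity)]
  have hQR : 4 * (12 * s ^ 2 * L + 2 * s + 1) ≤ η * R := by
    have : Q ≤ R := by linarith
    rw [hQ, div_le_iff₀ hη] at this
    linarith
  have a1 : |s ^ 2 * (R - r) * (R + r)| ≤ 12 * s ^ 2 * L * R := by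
    rw [abs_mul, abs_mul, abs_of_pos (pow_pos hs 2), abs_of_pos (by linarith : 0 < R + r)]
    have i1 : |R - r| ≤ 2 * L := by rw [abs_le]; constructor <;> linarith [hr.1, hr.2]
    have i2 : R + r ≤ 6 * R := by linarith [hr.2]
    calc s ^ 2 * |R - r| * (R + r) ≤ s ^ 2 * (2 * L) * (6 * R) := by gcongr
      _ = _ := by ring
  have a2 : |2 * s * R * α| ≤ 2 * s * R := by
    have := hα.1
    rw [abs_of_nonneg (by positivity)]
    have : α ≤ 1 := by linarith [hα.2]
    exact mul_le_of_le_one_right (by positivity) this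
  have a3 : |α ^ 2 - 1 / 4| ≤ 1 * R := by
    rw [abs_le]
    constructor <;> nlinarith [hα.1, hα.2]
  calc |s ^ 2 * (R - r) * (R + r) + 2 * s * R * α + (α ^ 2 - 1 / 4)|
      ≤ 12 * s ^ 2 * L * R + 2 * s * R + 1 * R :=
        (abs_add_le _ _).trans (add_le_add ((abs_add_le _ _).trans (add_le_add a1 a2)) a3)
    _ = 4 * (12 * s ^ 2 * L + 2 * s + 1) * (R / 4) := by ring
    _ ≤ η * R * (R / 4) := by gcongr
    _ = η * (R / 2) ^ 2 := by ring
    _ ≤ η * r ^ 2 := by gcongr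

/-! ### The spectrum above the ground state energy -/

lemma lintegral_enorm_sq_le_of_support {f : ℝ → ℂ} {a b C : ℝ} (h0 : ∀ x ∉ Icc a b, f x = 0)
    (hC : ∀ x ∈ Icc a b, ‖f x‖ ≤ C) :
    ∫⁻ r in Ioi (0 : ℝ), ‖f r‖ₑ ^ 2 ≤ ENNReal.ofReal (C ^ 2 * (b - a)) := by
  calc ∫⁻ r in Ioi (0 : ℝ), ‖f r‖ₑ ^ 2 ≤ ∫⁻ r, ‖f r‖ₑ ^ 2 := setLIntegral_le_lintegral _ _
    _ ≤ ∫⁻ r, (Icc a b).indicator (fun _ ↦ ENNReal.ofReal (C ^ 2)) r := by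
        refine lintegral_mono fun x ↦ ?_
        by_cases hx : x ∈ Icc a b
        · rw [indicator_of_mem hx, ← ofReal_norm, ← ENNReal.ofReal_pow (norm_nonneg _)]
          have := hC x hx
          exact ENNReal.ofReal_le_ofReal (by gcongr)
        · simp [h0 x hx]
    _ = _ := by
        rw [lintegral_indicator_const measurableSet_Icc, Real.volume_Icc,
          ← ENNReal.ofReal_mul (sq_nonneg C)]

lemma le_lintegral_enorm_sq {f : ℝ → ℂ} {a b c : ℝ} (ha : 0 < a) (hc : 0 ≤ c)
    (hf : ∀ x ∈ Icc a b, c ≤ ‖f x‖) :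
    ENNReal.ofReal (c ^ 2 * (b - a)) ≤ ∫⁻ r in Ioi (0 : ℝ), ‖f r‖ₑ ^ 2 := by
  calc ENNReal.ofReal (c ^ 2 * (b - a)) = ∫⁻ _ in Icc a b, ENNReal.ofReal (c ^ 2) := by
        rw [setLIntegral_const, Real.volume_Icc, ← ENNReal.ofReal_mul (sq_nonneg c)]
    _ ≤ ∫⁻ r in Icc a b, ‖f r‖ₑ ^ 2 := by
        refine setLIntegral_mono' measurableSet_Icc fun x hx ↦ ?_
        rw [← ofReal_norm, ← ENNReal.ofReal_pow (norm_nonneg _)]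
        have := hf x hx
        exact ENNReal.ofReal_le_ofReal (by gcongr)
    _ ≤ _ := lintegral_mono_set fun x hx ↦ ha.trans_le hx.1

section
variable {d α β E : ℝ} {φ dφ : ℝ → ℝ}

/-- The whole half-line above `E` is spectrum: the cut-off ground states `b((r - R)/L) φ(r)` in the
partial wave `l` with `l² ≈ (λ - E) R²`, where `1 ≪ L ≪ R`, form a Weyl sequence at `λ`. -/
lemma mem_opSpectrum_of_gt (hd : 0 < d) (hα : α ∈ Ioo (0 : ℝ) (1 / 2))
    (hE : IsGroundState d β E φ dφ) {B₀ : ℝ} (hφ : ∀ r, φ r ≤ B₀) (hφ' : ∀ r, 1 / 2 ≤ φ r)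
    {lam : ℝ} (hlam : E < lam) : (lam : ℂ) ∈ (hamiltonian d α β).opSpectrum := by
  intro hreg
  obtain ⟨K, hK⟩ := exists_bound_of_isRegularValue hd hreg
  obtain ⟨B, hB⟩ := hE.bounded_deriv
  obtain ⟨b, b', b'', C, hC, hb, hb', hb''c, h0, h1, h2, hone, hzero⟩ := exists_cutoff
  have hB0 : 0 < B₀ := (hE.pos 0).trans_le (hφ 0)
  have hB' : 0 ≤ B := (abs_nonneg _).trans (hB 0)
  set ε : ℝ := 1 / (4 * (K + 1)) with hε
  have hε0 : 0 < ε := by positivity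
  obtain ⟨L, hL1, hL⟩ : ∃ L : ℝ, 1 ≤ L ∧ (C * B₀ + 2 * C * B) / L ≤ ε / 2 := by
    refine ⟨max 1 ((C * B₀ + 2 * C * B) / (ε / 2)), le_max_left _ _, ?_⟩
    rw [div_le_iff₀ (lt_of_lt_of_le one_pos (le_max_left _ _))]
    have := le_max_right 1 ((C * B₀ + 2 * C * B) / (ε / 2))
    rw [div_le_iff₀ (by positivity)] at this
    linarith
  have hL0 : 0 < L := by linarith
  obtain ⟨l, R, hR, hl⟩ := exists_angular_momentum (μ := lam - E) (sub_pos.2 hlam) hα hL0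
    (η := ε / 2 / (C * B₀)) (by positivity)
  have hx : ∀ x, x ∉ Icc (R - 2 * L) (R + 2 * L) → (x - R) / L ∉ Icc (-2 : ℝ) 2 := by
    intro x hx h
    refine hx ⟨?_, ?_⟩
    · have := h.1
      rw [le_div_iff₀ hL0] at this
      linarith
    · have := h.2
      rw [div_le_iff₀ hL0] at this
      linarith
  have hlin : ∀ x, HasDerivAt (fun r : ℝ ↦ (r - R) / L) (1 / L) x := fun x ↦
    ((hasDerivAt_id x).sub_const R).div_const L
  have d1 : ∀ x, HasDerivAt (fun r ↦ b ((r - R) / L)) (b' ((x - R) / L) / L) x := fun x ↦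
    ((hb _).comp x (hlin x)).congr_deriv (by ring)
  have d2 : ∀ x, HasDerivAt (fun r ↦ b' ((r - R) / L) / L) (b'' ((x - R) / L) / L / L) x :=
    fun x ↦ (((hb' _).comp x (hlin x)).div_const L).congr_deriv (by ring)
  have c1 : ∀ x, |b' x / L| ≤ C / L := fun x ↦ by
    rw [abs_div, abs_of_pos hL0]
    have := h1 x
    gcongr
  have c2 : ∀ x, |b'' x / L / L| ≤ C / L := fun x ↦ by
    rw [abs_div, abs_div, abs_of_pos hL0, div_div]
    have i1 := h2 x
    have i2 : L ≤ L * L := le_mul_of_one_le_left hL0.le hL1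
    gcongr
  have cL : C / L ≤ C := div_le_self hC.le hL1
  have hG := radialGraph_mul_groundState (α := α) (l := l) hd hE hφ (a := R - 2 * L)
    (b := R + 2 * L) (by linarith) d1 d2 ((hb''c.comp (by fun_prop)).div_const L |>.div_const L)
    (fun x ↦ ⟨h0 _, (c1 _).trans cL, (c2 _).trans cL⟩)
    (fun x hx' ↦ by simp [hzero _ (hx x hx')])
  set χ : ℝ → ℝ := fun r ↦ b ((r - R) / L) with hχ
  set χ' : ℝ → ℝ := fun r ↦ b' ((r - R) / L) / L with hχ'
  set χ'' : ℝ → ℝ := fun r ↦ b'' ((r - R) / L) / L / L with hχ''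
  have hm0 : Measurable b := (continuous_iff_continuousAt.2 fun x ↦ (hb x).continuousAt).measurable
  have hm1 : Measurable b' :=
    (continuous_iff_continuousAt.2 fun x ↦ (hb' x).continuousAt).measurable
  have hm2 : Measurable b'' := hb''c.measurable
  have hφm := hE.measurable
  have hdφm := hE.measurable_deriv
  have key := hK l _ _ (by fun_prop) (by fun_prop) hG
  have lower := le_lintegral_enorm_sq (f := fun r ↦ ((χ r * φ r : ℝ) : ℂ)) (a := R - L)
    (b := R + L) (c := 1 / 2) (by linarith) (by norm_num) (fun x hx ↦ by
      have : (x - R) / L ∈ Icc (-1 : ℝ) 1 := by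
        constructor
        · rw [le_div_iff₀ hL0]; linarith [hx.1]
        · rw [div_le_iff₀ hL0]; linarith [hx.2]
      rw [Complex.norm_real, hχ]
      simp only [hone _ this, one_mul]
      rw [Real.norm_of_nonneg (hE.pos x).le]
      exact hφ' x)
  have upper := lintegral_enorm_sq_le_of_support (C := ε) (a := R - 2 * L) (b := R + 2 * L)
    (f := fun r ↦ ((centrifugal α l / r ^ 2 * (χ r * φ r) -
        (χ'' r * φ r + 2 * χ' r * dφ r - E * (χ r * φ r)) : ℝ) : ℂ) -
        lam * ((χ r * φ r : ℝ) : ℂ))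
    (fun x hx' ↦ by simp [hχ, hχ', hχ'', hzero _ (hx x hx')])
    (fun x hx' ↦ by
      rw [← Complex.ofReal_mul, ← Complex.ofReal_sub, Complex.norm_real, Real.norm_eq_abs]
      have e : centrifugal α l / x ^ 2 * (χ x * φ x) -
          (χ'' x * φ x + 2 * χ' x * dφ x - E * (χ x * φ x)) - lam * (χ x * φ x) =
          (centrifugal α l / x ^ 2 - (lam - E)) * (χ x * φ x) -
            (χ'' x * φ x + 2 * χ' x * dφ x) := by ring
      rw [e]
      have hφa : |φ x| ≤ B₀ := by rw [abs_of_pos (hE.pos x)]; exact hφ x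
      have t1 : |(centrifugal α l / x ^ 2 - (lam - E)) * (χ x * φ x)| ≤ ε / 2 := by
        rw [abs_mul, abs_mul]
        calc |centrifugal α l / x ^ 2 - (lam - E)| * (|χ x| * |φ x|)
            ≤ ε / 2 / (C * B₀) * (C * B₀) :=
              mul_le_mul (hl x hx') (mul_le_mul (h0 _) hφa (abs_nonneg _) hC.le)
                (by positivity) (by positivity)
          _ = ε / 2 := by field_simp
      have t2 : |χ'' x * φ x + 2 * χ' x * dφ x| ≤ ε / 2 := by
        refine (abs_add_le _ _).trans (le_trans ?_ hL)
        rw [abs_mul, abs_mul, abs_mul, abs_of_pos (two_pos : (0 : ℝ) < 2)]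
        calc |χ'' x| * |φ x| + 2 * |χ' x| * |dφ x| ≤ C / L * B₀ + 2 * (C / L) * B :=
              add_le_add (mul_le_mul (c2 _) hφa (abs_nonneg _) (by positivity))
                (mul_le_mul (mul_le_mul_of_nonneg_left (c1 _) two_pos.le) (hB x) (abs_nonneg _)
                  (by positivity))
          _ = _ := by ring
      linarith [abs_sub ((centrifugal α l / x ^ 2 - (lam - E)) * (χ x * φ x))
        (χ'' x * φ x + 2 * χ' x * dφ x)])
  have hfin := lower.trans (key.trans (mul_le_mul_right upper _))
  have hK2 : (K : ENNReal) ^ 2 = ENNReal.ofReal ((K : ℝ) ^ 2) := by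
    rw [ENNReal.ofReal_pow K.coe_nonneg, ENNReal.ofReal_coe_nnreal]
  rw [hK2, ← ENNReal.ofReal_mul (by positivity), ENNReal.ofReal_le_ofReal_iff
    (mul_nonneg (by positivity) (mul_nonneg (by positivity) (by linarith)))] at hfin
  have hKε : (K : ℝ) * ε ≤ 1 / 4 := by
    rw [hε, mul_one_div, div_le_iff₀ (by positivity)]
    linarith
  have hKε0 : 0 ≤ (K : ℝ) * ε := by positivity
  have : (K : ℝ) ^ 2 * ε ^ 2 ≤ 1 / 16 := by
    rw [← mul_pow]
    calc (K * ε) ^ 2 ≤ (1 / 4 : ℝ) ^ 2 := by gcongr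
      _ = _ := by norm_num
  nlinarith

/-- Every eigenvalue lies in `[E, ∞)`, and no point of `[E, ∞)` is isolated in the spectrum. -/
lemma discreteSpectrum_eq_empty (hd : 0 < d) (hα : α ∈ Ioo (0 : ℝ) (1 / 2))
    (hE : IsGroundState d β E φ dφ) (hφ : ∀ r, |(φ r ^ 2)⁻¹ - 1| ≤ 2 * α) :
    (hamiltonian d α β).discreteSpectrum = ∅ := by
  rw [eq_empty_iff_forall_notMem]
  rintro z ⟨-, ⟨ε, hε, hiso⟩, hne, -⟩
  have hlow : ∀ r, 1 / 2 ≤ φ r := fun r ↦ by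
    have h1 := (inv_le_two hα (hφ r)).2
    rw [inv_le_comm₀ (hE.pos r) two_pos] at h1
    linarith
  have hupp : ∀ r, φ r ≤ (1 - 2 * α)⁻¹ + 1 := fun r ↦ by
    have hp := hE.pos r
    have h0 : 0 < 1 - 2 * α := by linarith [hα.2]
    have h1 : 1 - 2 * α ≤ (φ r ^ 2)⁻¹ := by linarith [(abs_le.1 (hφ r)).1]
    rw [le_inv_comm₀ h0 (by positivity)] at h1
    nlinarith
  have hz : z.im = 0 ∧ E ≤ z.re := by
    by_contra hcon
    have hz' : z.im ≠ 0 ∨ z.re < E := by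
      by_contra h
      push Not at h
      exact hcon h
    obtain ⟨x, ⟨hx, hTx⟩, hx0⟩ := Submodule.exists_mem_ne_zero_of_ne_bot hne
    refine hx0 (eq_zero_of_partialWave x fun l ↦ ?_)
    have hg : (x, z • x) ∈ (hamiltonian d α β).graph := by
      rw [LinearPMap.mem_graph_iff]
      exact ⟨⟨x, hx⟩, rfl, hTx⟩
    rw [hamiltonian_graph hd] at hg
    obtain ⟨hF, -, F, dF, hfF, hpair⟩ := hg l
    have hgF : partialWave l (z • x : PlaneL2) =ᵐ[halfLine] fun r ↦ z * F r := by
      filter_upwards [partialWave_smul z x l, hfF] with r h1 h2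
      rw [h1, Pi.smul_apply, smul_eq_mul, h2]
    exact hfF.trans (hpair.ae_eq_zero hd hα hE hφ hz' hgF ((memLp_congr_ae hfF).1 hF))
  have hzr : z = (z.re : ℂ) := Complex.ext rfl (by simp [hz.1])
  have hw := hiso ((z.re + ε / 2 : ℝ) : ℂ)
    (mem_opSpectrum_of_gt hd hα hE hupp hlow (by linarith [hz.2])) (by
      rw [hzr, ← Complex.ofReal_sub, Complex.norm_real, Complex.ofReal_re, add_sub_cancel_left,
        Real.norm_of_nonneg (by positivity)]
      linarith)
  have := congrArg Complex.re hw
  rw [Complex.ofReal_re] at this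
  linarith

end

end AharonovBohm

theorem theorem4p1 (d : ℝ) (hd : 0 < d) (α : ℝ) (hα : α ∈ Set.Ioo (0 : ℝ) (1 / 2)) :
    ∃ β₀ : ℝ, 0 < β₀ ∧ ∀ β : ℝ, |β| < β₀ →
      (AharonovBohm.hamiltonian d α β).discreteSpectrum = ∅ := by
  obtain ⟨β₀, hβ₀, h⟩ := AharonovBohm.exists_isGroundState hd
    (ε := 2 * α) (by linarith [hα.1])
  refine ⟨β₀, hβ₀, fun β hβ ↦ ?_⟩
  obtain ⟨E, φ, dφ, hE, hφ⟩ := h β hβ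
  exact AharonovBohm.discreteSpectrum_eq_empty hd hα hE hφ
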